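/- Let $k$ be an algebraically closed field of characteristic zero and $n\ge 2$. Rational maps $\mathbb P^n\dashrightarrow\mathbb P^n$ are written $(f_0:\cdots:f_n)$ with forms $f_i$ of the same degree $\ge 1$, not all zero, proportional tuples defining the same map; $\mathrm{Cr}(\mathbb P^n)$ is the group (under composition) of birational ones. Fix $o=(0:\cdots:0:1)\in\mathbb P^n$, the hyperplane $H=\{x_n=0\}\cong\mathbb P^{n-1}$, and let $K$ be the function field of $H$, i.e. the field of quotients of two forms of the same degree in $k[x_0,\dots,x_{n-1}]$. Let $J_o(1;\mathbb P^n)\subset\mathrm{Cr}(\mathbb P^n)$ be the set of all $F$ for which there is a nonempty Zariski open set $U\subset\mathbb P^n$ such that $F|_U$ is biregular onto its image and, for every line $L\ni o$ with $L\cap U\ne\emptyset$, the closure $\overline{F(L\cap U)}$ is a line through $o$. Then $J_o(1;\mathbb P^n)$ is a subgroup of $\mathrm{Cr}(\mathbb P^n)$, and each $F\in J_o(1;\mathbb P^n)$ induces, by its action on general lines through $o$ (each line being identified with its intersection point with $H$), a unique element $\rho(F)\in\mathrm{Cr}(\mathbb P^{n-1})$; the map $\rho:J_o(1;\mathbb P^n)\to\mathrm{Cr}(\mathbb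 P^{n-1})$ is a group homomorphism. An $x_n$-monoid is a form $ax_n+b$ with $a,b$ forms in $k[x_0,\dots,x_{n-1}]$. Call a quadruple of forms $a,b,c,d\in k[x_0,\dots,x_{n-1}]$ admissible if for some $r\ge1$ they have degrees $r-1,\,r,\,r-2,\,r-1$ respectively (the zero polynomial being a form of every degree, and the only one of negative degree), $a\ne0$ or $c\ne 0$, and $\gcd(ax_n+b,cx_n+d)=1$. For admissible $a,b,c,d$ put $$\mathfrak f_{a,b,c,d}=\frac{ax_n+b}{cx_n+d}\in k(x_0,\dots,x_{n-1})(x_n),\qquad \mathfrak F_{a,b,c,d}=\bigl((cx_n+d)x_0:\cdots:(cx_n+d)x_{n-1}:ax_n+b\bigr).$$ (i) A Cremona map $F\in \mathrm{Cr}(\mathbb P^n)$ belongs to $J_o(1;\mathbb P^n)$ if and only if it has the form $(qg_0:\cdots:qg_{n-1}:f)$, where $(g_0:\cdots:g_{n-1})$, $g_i\in k[x_0,\dots,x_{n-1}]$, defines a Cremona map of $\mathbb P^{n-1}$, and $q,f\in k[x_0,\dots,x_n]$ are relatively prime $x_n$-monoids, at least one of which has positive $x_n$-degree. (ii) Sending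 the class of $\begin{pmatrix}\alpha&\beta\\ \gamma&\delta\end{pmatrix}$ to $x_0\cdot\dfrac{\alpha (x_n/x_0)+\beta}{\gamma (x_n/x_0)+\delta}$ (the Möbius transformation of the inhomogeneous coordinate $x_n/x_0$, written in $x_n$) defines a bijection from $\mathrm{PGL}(2,K)$ onto the set of all $\mathfrak f_{a,b,c,d}$ with $a,b,c,d$ admissible, which takes the product to composition of rational functions in the variable $x_n$. Thus $\mathrm{PGL}(2,K)$ is identified with the Möbius group of all $\mathfrak f_{a,b,c,d}$. (iii) Under this identification, $\mathfrak f_{a,b,c,d}\mapsto\mathfrak F_{a,b,c,d}$ is a well-defined injective group homomorphism $\psi:\mathrm{PGL}(2,K)\to J_o(1;\mathbb P^n)$. (iv) $\operatorname{im}\psi=\ker\rho$; in particular, for admissible $a,b,c,d$, the map $\mathfrak F_{a,b,c,d}$ maps a general line through $o$ birationally to itself. -/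

import Mathlib

open scoped LinearAlgebra.Projectivization MatrixGroups
open MvPolynomial

noncomputable section

namespace Cremona

/-! ### Dominant rational self-maps of projective space and the Cremona group -/

/-- A tuple of `n + 1` forms in `n + 1` variables, all of the same degree `d ≥ 1`, whose associated
rational self-map of `ℙⁿ` is dominant: no nonzero form vanishes identically on its image. (In
particular the forms are not all zero.) -/
structure FormTuple (k : Type*) [Field k] (n : ℕ) where
  form : Fin (n + 1) → MvPolynomial (Fin (n + 1)) k
  exists_degree : ∃ d : ℕ, 1 ≤ d ∧ ∀ i, (form i).IsHomogeneous d
  dominant : ∀ (h : MvPolynomial (Fin (n + 1)) k) (e : ℕ),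
    h.IsHomogeneous e → h ≠ 0 → bind₁ form h ≠ 0

variable {k : Type*} [Field k] {n : ℕ}

theorem FormTuple.form_ne_zero (f : FormTuple k n) (i : Fin (n + 1)) : f.form i ≠ 0 := by
  have h := f.dominant (X i) 1 (isHomogeneous_X k i) (X_ne_zero i)
  rwa [bind₁_X_right] at h

/-- Two tuples of forms define the same rational map iff they are proportional. -/
instance FormTuple.setoid (k : Type*) [Field k] (n : ℕ) : Setoid (FormTuple k n) where
  r f g := ∀ i j, f.form i * g.form j = f.form j * g.form i
  iseqv :=
    { refl := fun f i j => mul_comm _ _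
      symm := fun {f g} h i j => by
        rw [mul_comm, h j i, mul_comm]
      trans := fun {f g h} h₁ h₂ i j => by
        apply mul_right_cancel₀ (g.form_ne_zero 0)
        linear_combination (h.form j) * h₁ i 0 + f.form 0 * h₂ i j - (h.form i) * h₁ j 0 }

theorem bind₁_mul_left {σ τ : Type*} {h : MvPolynomial σ k} {e : ℕ} (hh : h.IsHomogeneous e)
    (p : MvPolynomial τ k) (g : σ → MvPolynomial τ k) :
    bind₁ (fun i => p * g i) h = p ^ e * bind₁ g h := by
  simp only [← aeval_eq_bind₁, aeval_def, eval₂_eq, Finset.mul_sum]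
  refine Finset.sum_congr rfl fun d hd => ?_
  have hdeg : d.degree = e := by
    by_contra hne
    exact (mem_support_iff.mp hd) (hh.coeff_eq_zero hne)
  simp only [mul_pow, Finset.prod_mul_distrib, Finset.prod_pow_eq_pow_sum]
  rw [show ∑ i ∈ d.support, d i = e from hdeg]
  ring

/-- Composition `f ∘ g`: substitute the forms of `g` into those of `f`. -/
def FormTuple.comp (f g : FormTuple k n) : FormTuple k n where
  form i := bind₁ g.form (f.form i)
  exists_degree := by
    obtain ⟨d, hd, hf⟩ := f.exists_degree
    obtain ⟨e, he, hg⟩ := g.exists_degree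
    exact ⟨e * d, Nat.mul_pos he hd, fun i => (hf i).aeval _ hg⟩
  dominant h e hh h0 := by
    obtain ⟨d, hd, hf⟩ := f.exists_degree
    rw [← bind₁_bind₁]
    exact g.dominant _ (d * e) (hh.aeval _ hf) (f.dominant h e hh h0)

/-- The identity map `(x₀ : ⋯ : xₙ)`. -/
def FormTuple.id (k : Type*) [Field k] (n : ℕ) : FormTuple k n where
  form := X
  exists_degree := ⟨1, le_rfl, fun i => isHomogeneous_X k i⟩
  dominant h e hh h0 := by rwa [← aeval_eq_bind₁, aeval_X_left_apply]

theorem FormTuple.comp_congr {f f' g g' : FormTuple k n} (hf : f ≈ f') (hg : g ≈ g') :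
    f.comp g ≈ f'.comp g' := by
  intro i j
  obtain ⟨e, he, hf'⟩ := f'.exists_degree
  have key : ∀ j, g'.form 0 ^ e * bind₁ g.form (f'.form j)
      = g.form 0 ^ e * bind₁ g'.form (f'.form j) := by
    intro j
    rw [← bind₁_mul_left (hf' j), ← bind₁_mul_left (hf' j)]
    congr 2
    funext i
    rw [mul_comm]
    exact hg i 0
  have h1 : bind₁ g.form (f.form i) * bind₁ g.form (f'.form j)
      = bind₁ g.form (f.form j) * bind₁ g.form (f'.form i) := by
    rw [← map_mul, ← map_mul, hf i j]
  apply mul_right_cancel₀ (pow_ne_zero e (g.form_ne_zero 0))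
  simp only [FormTuple.comp]
  linear_combination g'.form 0 ^ e * h1 - bind₁ g.form (f.form i) * key j
    + bind₁ g.form (f.form j) * key i

/-- Dominant rational maps `ℙⁿ ⇢ ℙⁿ`. -/
def RatMap (k : Type*) [Field k] (n : ℕ) : Type _ := Quotient (FormTuple.setoid k n)

/-- Dominant rational self-maps form a monoid under composition: `F * G = F ∘ G`. -/
instance (k : Type*) [Field k] (n : ℕ) : Monoid (RatMap k n) where
  mul := Quotient.map₂ FormTuple.comp fun _ _ hf _ _ hg => FormTuple.comp_congr hf hg
  one := Quotient.mk _ (FormTuple.id k n)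
  mul_assoc := by
    rintro ⟨f⟩ ⟨g⟩ ⟨h⟩
    refine congrArg (Quotient.mk _) ?_
    simp only [FormTuple.comp, FormTuple.mk.injEq]
    funext i
    rw [bind₁_bind₁]
  one_mul := by
    rintro ⟨f⟩
    refine congrArg (Quotient.mk _) ?_
    cases f
    simp only [FormTuple.comp, FormTuple.id, FormTuple.mk.injEq]
    funext i
    rw [bind₁_X_right]
  mul_one := by
    rintro ⟨f⟩
    refine congrArg (Quotient.mk _) ?_
    cases f
    simp only [FormTuple.comp, FormTuple.id, FormTuple.mk.injEq]
    funext i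
    rw [← aeval_eq_bind₁, aeval_X_left_apply]

/-- The Cremona group of `ℙⁿ`: rational self-maps with a rational inverse. -/
abbrev Cr (k : Type*) [Field k] (n : ℕ) : Type _ := (RatMap k n)ˣ

/-- `F` is the rational map `(f₀ : ⋯ : fₙ)`. -/
def RatMap.HasForm (F : RatMap k n) (f : Fin (n + 1) → MvPolynomial (Fin (n + 1)) k) : Prop :=
  ∃ t : FormTuple k n, t.form = f ∧ (Quotient.mk _ t : RatMap k n) = F

/-! ### Points, Zariski topology, linear subspaces -/

/-- The set of `k`-points of `ℙⁿ`. -/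
abbrev Pts (k : Type*) [Field k] (n : ℕ) : Type _ := ℙ k (Fin (n + 1) → k)

/-- Zero loci of sets of forms. -/
def IsZariskiClosed (Z : Set (Pts k n)) : Prop :=
  ∃ S : Set (MvPolynomial (Fin (n + 1)) k), (∀ f ∈ S, ∃ d, f.IsHomogeneous d) ∧
    Z = {p | ∀ f ∈ S, eval p.rep f = 0}

def IsZariskiOpen (U : Set (Pts k n)) : Prop := IsZariskiClosed Uᶜ

def zariskiClosure (T : Set (Pts k n)) : Set (Pts k n) :=
  ⋂₀ {Z | IsZariskiClosed Z ∧ T ⊆ Z}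

/-- The linear subspace of `ℙⁿ` given by a vector subspace. -/
def linearSubspace (W : Submodule k (Fin (n + 1) → k)) : Set (Pts k n) :=
  {p | p.submodule ≤ W}

/-- The set of `m`-dimensional linear subspaces of `ℙⁿ` containing the point `o`. -/
def schubert (o : Pts k n) (m : ℕ) : Set (Set (Pts k n)) :=
  {L | ∃ W : Submodule k (Fin (n + 1) → k),
    Module.finrank k W = m + 1 ∧ o ∈ linearSubspace W ∧ L = linearSubspace W}

/-! ### Values of rational maps -/

/-- `F` is defined at `p` with value `p'`: some tuple of forms representing `F` does not vanish
at `p`, and takes there the value `p'`. -/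
def RatMap.SendsTo (F : RatMap k n) (p p' : Pts k n) : Prop :=
  ∃ (f : FormTuple k n) (h : (fun i => eval p.rep (f.form i)) ≠ 0),
    (Quotient.mk _ f : RatMap k n) = F ∧ p' = Projectivization.mk k _ h

/-- The domain of definition. -/
def RatMap.dom (F : RatMap k n) : Set (Pts k n) := {p | ∃ p', F.SendsTo p p'}

/-- The image of the part of `T` where `F` is defined. -/
def RatMap.image (F : RatMap k n) (T : Set (Pts k n)) : Set (Pts k n) :=
  {p' | ∃ p ∈ T, F.SendsTo p p'}

/-- The restriction of `F` to `U` is biregular onto its image, an open set. -/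
def RatMap.BiregularOn (F : RatMap k n) (U : Set (Pts k n)) : Prop :=
  U ⊆ F.dom ∧ IsZariskiOpen (F.image U) ∧
    ∃ G : RatMap k n, ∀ p ∈ U, ∀ p', F.SendsTo p p' → G.SendsTo p' p

/-- De Jonquières maps of type `m` with center `o`. -/
def IsDeJonquieres (m : ℕ) (o : Pts k n) (F : Cr k n) : Prop :=
  ∃ U : Set (Pts k n), U.Nonempty ∧ IsZariskiOpen U ∧ (F : RatMap k n).BiregularOn U ∧
    ∀ L ∈ schubert o m, (L ∩ U).Nonempty →
      zariskiClosure ((F : RatMap k n).image (L ∩ U)) ∈ schubert o m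

/-! ### The center `o = (0 : ⋯ : 0 : 1)`, the hyperplane `H` and lines through `o` -/

/-- The point `(0 : ⋯ : 0 : 1)` of `ℙⁿ⁺¹`. -/
def center (k : Type*) [Field k] (n : ℕ) : Pts k (n + 1) :=
  Projectivization.mk k (Pi.single (Fin.last (n + 1)) 1) (by simp)

/-- `v ↦ (v, 0)`. -/
def hyperplaneMap (k : Type*) [Field k] (n : ℕ) : (Fin (n + 1) → k) →ₗ[k] (Fin (n + 2) → k) where
  toFun v := Fin.snoc (α := fun _ => k) v 0
  map_add' v w := by
    funext i
    refine Fin.lastCases ?_ (fun j => ?_) i <;> simp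
  map_smul' c v := by
    funext i
    refine Fin.lastCases ?_ (fun j => ?_) i <;> simp

theorem hyperplaneMap_injective (k : Type*) [Field k] (n : ℕ) :
    Function.Injective (hyperplaneMap k n) := by
  intro v w h
  funext i
  have := congrFun h i.castSucc
  simpa [hyperplaneMap] using this

/-- The embedding of `ℙⁿ` in `ℙⁿ⁺¹` as the hyperplane where the last coordinate vanishes. -/
def toHyperplane (y : Pts k n) : Pts k (n + 1) :=
  Projectivization.map (hyperplaneMap k n) (hyperplaneMap_injective k n) y

/-- The line through `o` and the point `y` of the hyperplane. -/
def lineThrough (y : Pts k n) : Set (Pts k (n + 1)) :=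
  linearSubspace ((center k n).submodule ⊔ (toHyperplane y).submodule)

/-- `F` sends the general line through `o` to a line through `o`, and, the lines through `o` being
identified with their intersections with the hyperplane, `G` is the induced map. -/
def InducesOnLines (F : Cr k (n + 1)) (G : Cr k n) : Prop :=
  ∃ V : Set (Pts k n), V.Nonempty ∧ IsZariskiOpen V ∧
    ∀ y ∈ V, ∃ z, (G : RatMap k n).SendsTo y z ∧
      zariskiClosure ((F : RatMap k (n + 1)).image (lineThrough y)) = lineThrough z

/-- `F` maps the general line through `o` birationally to itself. -/
def FixesGeneralLine (F : Cr k (n + 1)) : Prop :=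
  ∃ U : Set (Pts k (n + 1)), U.Nonempty ∧ IsZariskiOpen U ∧
    (F : RatMap k (n + 1)).BiregularOn U ∧
    ∀ L ∈ schubert (center k n) 1, (L ∩ U).Nonempty →
      zariskiClosure ((F : RatMap k (n + 1)).image (L ∩ U)) = L

/-! ### Monoids in the last variable -/

/-- Forms in all variables but the last, as polynomials in all variables. -/
def lift (p : MvPolynomial (Fin (n + 1)) k) : MvPolynomial (Fin (n + 2)) k :=
  rename Fin.castSucc p

/-- The polynomial `a xₗ + b`, with `xₗ` the last variable. -/
def monoidForm (a b : MvPolynomial (Fin (n + 1)) k) : MvPolynomial (Fin (n + 2)) k :=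
  lift a * X (Fin.last (n + 1)) + lift b

/-- A form `a xₗ + b`, with `a` and `b` forms not involving the last variable `xₗ`. -/
def IsLastMonoid (p : MvPolynomial (Fin (n + 2)) k) : Prop :=
  (∃ e, p.IsHomogeneous e) ∧ ∃ a b : MvPolynomial (Fin (n + 1)) k,
    (∃ e, a.IsHomogeneous e) ∧ (∃ e, b.IsHomogeneous e) ∧ p = monoidForm a b

/-- The tuple `(q g₀, …, q gₙ, f)`. -/
def coneTuple (q f : MvPolynomial (Fin (n + 2)) k)
    (g : Fin (n + 1) → MvPolynomial (Fin (n + 1)) k) :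
    Fin (n + 2) → MvPolynomial (Fin (n + 2)) k :=
  Fin.snoc (α := fun _ => MvPolynomial (Fin (n + 2)) k) (fun i => q * lift (g i)) f

/-! ### The Möbius group -/

/-- The field of fractions of `k[x₀, …, xₙ]`. -/
abbrev Frac (k : Type*) [Field k] (n : ℕ) : Type _ := FractionRing (MvPolynomial (Fin (n + 1)) k)

/-- The function field of `ℙⁿ`: quotients of two forms of the same degree. -/
def functionField (k : Type*) [Field k] (n : ℕ) : Subfield (Frac k n) where
  carrier := {u | ∃ (d : ℕ) (p q : MvPolynomial (Fin (n + 1)) k), p.IsHomogeneous d ∧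
    q.IsHomogeneous d ∧ q ≠ 0 ∧ u = algebraMap _ (Frac k n) p / algebraMap _ (Frac k n) q}
  zero_mem' := ⟨0, 0, 1, isHomogeneous_zero _ _ _, isHomogeneous_one _ _, one_ne_zero, by simp⟩
  one_mem' := ⟨0, 1, 1, isHomogeneous_one _ _, isHomogeneous_one _ _, one_ne_zero, by simp⟩
  mul_mem' := by
    rintro _ _ ⟨d, p, q, hp, hq, h0, rfl⟩ ⟨d', p', q', hp', hq', h0', rfl⟩
    refine ⟨d + d', p * p', q * q', hp.mul hp', hq.mul hq', mul_ne_zero h0 h0', ?_⟩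
    rw [map_mul, map_mul, div_mul_div_comm]
  add_mem' := by
    rintro _ _ ⟨d, p, q, hp, hq, h0, rfl⟩ ⟨d', p', q', hp', hq', h0', rfl⟩
    refine ⟨d + d', p * q' + q * p', q * q', (hp.mul hq').add (hq.mul hp'), hq.mul hq',
      mul_ne_zero h0 h0', ?_⟩
    rw [map_mul, map_add, map_mul, map_mul, div_add_div]
    · simpa using h0
    · simpa using h0'
  neg_mem' := by
    rintro _ ⟨d, p, q, hp, hq, h0, rfl⟩
    exact ⟨d, -p, q, hp.neg, hq, h0, by rw [map_neg, neg_div]⟩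
  inv_mem' := by
    rintro _ ⟨d, p, q, hp, hq, h0, rfl⟩
    by_cases hp0 : p = 0
    · exact ⟨0, 0, 1, isHomogeneous_zero _ _ _, isHomogeneous_one _ _, one_ne_zero, by simp [hp0]⟩
    · exact ⟨d, q, p, hq, hp, hp0, by rw [inv_div]⟩

/-- Forms of degree `e`; the only form of negative degree is `0`. -/
def IsFormOfDegree (p : MvPolynomial (Fin (n + 1)) k) (e : ℤ) : Prop :=
  p = 0 ∨ ∃ m : ℕ, (m : ℤ) = e ∧ p.IsHomogeneous m

/-- The conditions on the forms `a, b, c, d`. -/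
def Admissible (a b c d : MvPolynomial (Fin (n + 1)) k) : Prop :=
  (∃ r : ℤ, 1 ≤ r ∧ IsFormOfDegree a (r - 1) ∧ IsFormOfDegree b r ∧ IsFormOfDegree c (r - 2) ∧
    IsFormOfDegree d (r - 1)) ∧
  (a ≠ 0 ∨ c ≠ 0) ∧ IsRelPrime (monoidForm a b) (monoidForm c d)

/-- Constants in `k(x₀, …, xₙ)(t)` coming from polynomials. -/
def const (p : MvPolynomial (Fin (n + 1)) k) : RatFunc (Frac k n) :=
  RatFunc.C (algebraMap _ (Frac k n) p)

/-- The rational function `(a t + b) / (c t + d)` in the variable `t` over `k(x₀, …, xₙ)`. -/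
def moebius (a b c d : MvPolynomial (Fin (n + 1)) k) : RatFunc (Frac k n) :=
  (const a * RatFunc.X + const b) / (const c * RatFunc.X + const d)

/-- The set of all Möbius functions `(a t + b) / (c t + d)` with admissible `a, b, c, d`. -/
def moebiusSet (k : Type*) [Field k] (n : ℕ) : Set (RatFunc (Frac k n)) :=
  {u | ∃ a b c d : MvPolynomial (Fin (n + 1)) k, Admissible a b c d ∧ u = moebius a b c d}

/-- Composition `u ∘ v` of rational functions: substitute `v` for the variable in `u`. -/
def compose (u v : RatFunc (Frac k n)) : RatFunc (Frac k n) :=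
  RatFunc.eval RatFunc.C v u

/-- The function `x₀ · (α (t / x₀) + β) / (γ (t / x₀) + δ)` of a matrix with rows `(α, β)` and
`(γ, δ)` over the function field: the Möbius transformation of the inhomogeneous coordinate
`t / x₀`, written in `t`. -/
def ofMatrix (g : GL (Fin 2) (functionField k n)) : RatFunc (Frac k n) :=
  const (X 0) *
    ((RatFunc.C (g 0 0 : Frac k n) * (RatFunc.X / const (X 0)) + RatFunc.C (g 0 1 : Frac k n)) /
     (RatFunc.C (g 1 0 : Frac k n) * (RatFunc.X / const (X 0)) + RatFunc.C (g 1 1 : Frac k n)))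

end Cremona

end

/-!
A rational self-map of `ℙⁿ⁺¹` permutes the general lines through the center `o` exactly when the
first `n + 1` entries of its tuple are proportional to forms `g₀, …, gₙ` in `x₀, …, xₙ`, that is,
when projection from `o` carries it to the map `g` of `ℙⁿ` (`FormTuple.LiesOver`). This algebraic
condition is compatible with composition and determines `g`. Geometrically, a Cremona map over `g`
is an isomorphism on a basic open set (`biregularOn_basicOpen`), and it sends a line through `o`
meeting that set onto an infinite, hence dense, subset of the line given by `g`
(`RatMap.LiesOver.exists_basicOpen`). Conversely, if lines through `o` go to lines through `o`, then
the first entries are proportional to their coefficients at a fixed power of the last variable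
(`exists_liesOver_of_isDeJonquieres`).

A map over `g` has the form `(x, t) ↦ (g(x), y)` on the generic line, where
`y ∈ k(x₀, …, xₙ)(t)` is its fibre coordinate (`fibreCoord`). If the map has a rational inverse,
`t` is a rational function of `y` over `k(x₀, …, xₙ)`, so `y` generates `k(x₀, …, xₙ)(t)`
(`adjoin_fibreCoord_eq_top`). Two consequences follow. Since `y` is transcendental over
`k(x₀, …, xₙ)`, the entries of the inverse, as polynomials in `y`, can be compared coefficientwise,
which shows that the inverse lies over an inverse of `g` (`FormTuple.LiesOver.exists_leftInverse`);
so these maps form a group, and passing to `g` is a homomorphism of groups. Since the degree of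
`k(x₀, …, xₙ)(t)` over `k(x₀, …, xₙ)(y)` is the degree of `y`, numerator and denominator of `y`
are at most linear in `t`; in lowest terms they are the two coprime monoids of the normal form
(`FormTuple.LiesOver.exists_coneTuple`).

The maps over the identity are determined by their fibre coordinates, and composition of maps is
composition of fibre coordinates (`FormTuple.LiesOver.fibreCoord_comp`). By the normal form these
coordinates are the Möbius functions of admissible quadruples. Clearing denominators and removing
the greatest common divisor identifies the latter with the Möbius functions of matrices over the
function field (`ofMatrix_mem`, `exists_ofMatrix_eq`), of which exactly the scalar ones give the
identity (`ofMatrix_eq_X_iff`).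
-/

noncomputable section

namespace Cremona

variable {k : Type*} [Field k] {n : ℕ}

/-! ### Homogeneous polynomials -/

/-- Scaling the values of the variables by `s` scales the value of a form of degree `e`
by `s ^ e`. -/
theorem map_eq_pow_mul_map {σ A : Type*} [CommRing A] {h : MvPolynomial σ k} {e : ℕ}
    (hh : h.IsHomogeneous e) (φ ψ : MvPolynomial σ k →+* A) (s : A)
    (hC : ∀ c, φ (C c) = ψ (C c)) (hX : ∀ i, φ (X i) = s * ψ (X i)) : φ h = s ^ e * ψ h := by
  have h1 : ∀ χ : MvPolynomial σ k →+* A, χ h = ∑ d ∈ h.support,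
      χ (C (coeff d h)) * ∏ i ∈ d.support, χ (X i) ^ d i := by
    intro χ
    conv_lhs => rw [h.as_sum]
    rw [map_sum]
    refine Finset.sum_congr rfl fun d _ => ?_
    rw [monomial_eq, map_mul, Finsupp.prod, map_prod]
    simp only [map_pow]
  rw [h1 φ, h1 ψ, Finset.mul_sum]
  refine Finset.sum_congr rfl fun d hd => ?_
  have hdeg : d.degree = e := by
    by_contra hne
    exact (mem_support_iff.mp hd) (hh.coeff_eq_zero hne)
  simp only [hC, hX, mul_pow, Finset.prod_mul_distrib, Finset.prod_pow_eq_pow_sum]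
  rw [show ∑ i ∈ d.support, d i = e from hdeg]
  ring

theorem eval_smul_of_isHomogeneous {σ : Type*} {h : MvPolynomial σ k} {e : ℕ}
    (hh : h.IsHomogeneous e) (c : k) (v : σ → k) : eval (c • v) h = c ^ e * eval v h :=
  map_eq_pow_mul_map hh (eval (c • v)) (eval v) c (fun a => by simp) fun i => by simp

/-- The substitution `xᵢ ↦ xᵢ T`, which separates the homogeneous components by powers of `T`. -/
def gradeMap (σ k : Type*) [Field k] : MvPolynomial σ k →+* Polynomial (MvPolynomial σ k) :=
  eval₂Hom (Polynomial.C.comp C) fun i => Polynomial.X * Polynomial.C (X i)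

theorem gradeMap_of_isHomogeneous {σ : Type*} {h : MvPolynomial σ k} {e : ℕ}
    (hh : h.IsHomogeneous e) : gradeMap σ k h = Polynomial.X ^ e * Polynomial.C h :=
  map_eq_pow_mul_map hh _ Polynomial.C _ (fun a => by simp [gradeMap]) fun i => by simp [gradeMap]

theorem coeff_gradeMap {σ : Type*} (h : MvPolynomial σ k) (e : ℕ) :
    (gradeMap σ k h).coeff e = homogeneousComponent e h := by
  conv_lhs => rw [← sum_homogeneousComponent h, map_sum]
  simp only [gradeMap_of_isHomogeneous (homogeneousComponent_isHomogeneous _ h),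
    Polynomial.finsetSum_coeff, mul_comm (Polynomial.X ^ _), Polynomial.coeff_C_mul_X_pow]
  rw [Finset.sum_ite_eq, ite_eq_left_iff, Finset.mem_range]
  intro hlt
  exact (homogeneousComponent_eq_zero e h (by omega)).symm

/-- The factors of a form are forms: in the image of `gradeMap` a product is a monomial only if its
factors are. -/
theorem exists_isHomogeneous_of_mul {σ : Type*} {p q : MvPolynomial σ k} {e : ℕ}
    (h : (p * q).IsHomogeneous e) (h0 : p * q ≠ 0) : ∃ d, p.IsHomogeneous d := by
  have hinj : Function.Injective (gradeMap σ k) := by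
    have h1 : (Polynomial.evalRingHom 1).comp (gradeMap σ k) = RingHom.id _ :=
      MvPolynomial.ringHom_ext (fun c => by simp [gradeMap]) fun i => by simp [gradeMap]
    exact Function.LeftInverse.injective (RingHom.congr_fun h1)
  have hp0 : gradeMap σ k p ≠ 0 := by
    rw [Ne, map_eq_zero_iff _ hinj]; exact left_ne_zero_of_mul h0
  have hq0 : gradeMap σ k q ≠ 0 := by
    rw [Ne, map_eq_zero_iff _ hinj]; exact right_ne_zero_of_mul h0
  have hm := gradeMap_of_isHomogeneous h
  rw [map_mul, mul_comm (Polynomial.X ^ e)] at hm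
  have hd := congrArg Polynomial.natDegree hm
  rw [Polynomial.natDegree_mul hp0 hq0, Polynomial.natDegree_C_mul_X_pow _ _ h0] at hd
  have ht := congrArg Polynomial.natTrailingDegree hm
  rw [Polynomial.natTrailingDegree_mul hp0 hq0,
    Polynomial.C_mul_X_pow_eq_monomial, Polynomial.natTrailingDegree_monomial h0] at ht
  have h1 := Polynomial.natTrailingDegree_le_natDegree (gradeMap σ k p)
  have h2 := Polynomial.natTrailingDegree_le_natDegree (gradeMap σ k q)
  refine ⟨(gradeMap σ k p).natDegree, ?_⟩
  have h3 : p = homogeneousComponent (gradeMap σ k p).natDegree p := by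
    conv_lhs => rw [← sum_homogeneousComponent p]
    refine Finset.sum_eq_single_of_mem _ ?_ fun i _ hi => ?_
    · rw [Finset.mem_range]
      by_contra hlt
      apply Polynomial.leadingCoeff_ne_zero.mpr hp0
      rw [Polynomial.leadingCoeff, coeff_gradeMap]
      exact homogeneousComponent_eq_zero _ _ (by omega)
    · rw [← coeff_gradeMap]
      rcases lt_or_gt_of_ne hi with hi | hi
      · exact Polynomial.coeff_eq_zero_of_lt_natTrailingDegree (by omega)
      · exact Polynomial.coeff_eq_zero_of_natDegree_lt hi
  have h4 := homogeneousComponent_isHomogeneous (gradeMap σ k p).natDegree p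
  rwa [← h3] at h4

/-! ### Polynomials in the last variable -/

theorem finRotate_castSucc (i : Fin (n + 1)) : finRotate (n + 2) i.castSucc = i.succ := by
  rw [finRotate_apply, Fin.coeSucc_eq_succ]

/-- Polynomials in `x₀, …, xₙ₊₁` as polynomials in the last variable over `k[x₀, …, xₙ]`. -/
def lastEquiv (k : Type*) [Field k] (n : ℕ) :
    MvPolynomial (Fin (n + 2)) k ≃ₐ[k] Polynomial (MvPolynomial (Fin (n + 1)) k) :=
  (renameEquiv k (finRotate (n + 2))).trans (finSuccEquiv k (n + 1))

@[simp] theorem lastEquiv_last : lastEquiv k n (X (Fin.last (n + 1))) = Polynomial.X := by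
  simp only [lastEquiv, AlgEquiv.trans_apply, renameEquiv_apply, rename_X, finRotate_last,
    finSuccEquiv_X_zero]

@[simp] theorem lastEquiv_castSucc (i : Fin (n + 1)) :
    lastEquiv k n (X i.castSucc) = Polynomial.C (X i) := by
  simp only [lastEquiv, AlgEquiv.trans_apply, renameEquiv_apply, rename_X, finRotate_castSucc,
    finSuccEquiv_X_succ]

@[simp] theorem lastEquiv_C (c : k) : lastEquiv k n (C c) = Polynomial.C (C c) :=
  (lastEquiv k n).commutes c

@[simp] theorem lastEquiv_lift (p : MvPolynomial (Fin (n + 1)) k) :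
    lastEquiv k n (lift p) = Polynomial.C p := by
  have h : ((lastEquiv k n).toRingEquiv.toRingHom.comp (rename Fin.castSucc).toRingHom) =
      Polynomial.C := by
    refine MvPolynomial.ringHom_ext (fun c => ?_) fun i => ?_
    · simp
    · simp
  exact RingHom.congr_fun h p

theorem lastEquiv_monoidForm (a b : MvPolynomial (Fin (n + 1)) k) :
    lastEquiv k n (monoidForm a b) = Polynomial.C a * Polynomial.X + Polynomial.C b := by
  simp [monoidForm]

theorem isHomogeneous_coeff_lastEquiv {h : MvPolynomial (Fin (n + 2)) k} {e : ℕ}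
    (hh : h.IsHomogeneous e) {i j : ℕ} (hij : i + j = e) :
    ((lastEquiv k n h).coeff i).IsHomogeneous j :=
  (hh.rename_isHomogeneous (f := finRotate (n + 2))).finSuccEquiv_coeff_isHomogeneous i j hij

theorem coeff_lastEquiv_eq_zero {h : MvPolynomial (Fin (n + 2)) k} {e : ℕ}
    (hh : h.IsHomogeneous e) {i : ℕ} (hi : e < i) : (lastEquiv k n h).coeff i = 0 := by
  by_contra h0
  obtain ⟨m, hm⟩ := MvPolynomial.ne_zero_iff.mp h0
  have h1 : coeff (m.cons i) (rename (finRotate (n + 2)) h) ≠ 0 := by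
    rw [← finSuccEquiv_coeff_coeff]
    exact hm
  have h2 := (hh.rename_isHomogeneous (f := finRotate (n + 2))) h1
  have h3 : (Finsupp.weight 1) (Finsupp.cons i m) = i + m.degree := by
    simp only [Finsupp.weight_apply, Pi.one_apply, smul_eq_mul, mul_one, Finsupp.sum_cons]
    rfl
  change (Finsupp.weight 1) (Finsupp.cons i m) = e at h2
  omega

theorem natDegree_lastEquiv (h : MvPolynomial (Fin (n + 2)) k) :
    (lastEquiv k n h).natDegree = h.degreeOf (Fin.last (n + 1)) := by
  have h1 := natDegree_finSuccEquiv (rename (finRotate (n + 2)) h)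
  have h2 := degreeOf_rename_of_injective (p := h) (finRotate (n + 2)).injective
    (Fin.last (n + 1))
  rw [finRotate_last] at h2
  rw [← h2, ← h1]
  rfl

theorem lift_injective : Function.Injective (lift : MvPolynomial (Fin (n + 1)) k → _) :=
  rename_injective _ (Fin.castSucc_injective _)

theorem lift_mul (p q : MvPolynomial (Fin (n + 1)) k) : lift (p * q) = lift p * lift q :=
  map_mul _ p q

@[simp] theorem lift_zero : lift (0 : MvPolynomial (Fin (n + 1)) k) = 0 := map_zero _

@[simp] theorem lift_X (i : Fin (n + 1)) :
    lift (X i : MvPolynomial (Fin (n + 1)) k) = X i.castSucc := rename_X _ _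

theorem lift_ne_zero {p : MvPolynomial (Fin (n + 1)) k} (hp : p ≠ 0) : lift p ≠ 0 := fun h =>
  hp (lift_injective (h.trans lift_zero.symm))

theorem isHomogeneous_lift {p : MvPolynomial (Fin (n + 1)) k} {e : ℕ} (hp : p.IsHomogeneous e) :
    (lift p).IsHomogeneous e := hp.rename_isHomogeneous

theorem bind₁_lift {τ : Type*} (t : Fin (n + 2) → MvPolynomial τ k)
    (p : MvPolynomial (Fin (n + 1)) k) :
    bind₁ t (lift p) = bind₁ (fun i => t i.castSucc) p := by
  rw [lift, bind₁_rename]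
  rfl

theorem lift_bind₁ (g : Fin (n + 1) → MvPolynomial (Fin (n + 1)) k)
    (p : MvPolynomial (Fin (n + 1)) k) :
    lift (bind₁ g p) = bind₁ (fun i => lift (g i)) p := by
  rw [lift, rename_bind₁]
  rfl

theorem eval_lift (v : Fin (n + 2) → k) (p : MvPolynomial (Fin (n + 1)) k) :
    eval v (lift p) = eval (fun i => v i.castSucc) p := by
  rw [lift, eval_rename]
  rfl

/-- Values of a polynomial along a line through the center, computed in the last variable. -/
theorem eval_eq_eval_lastEquiv (v : Fin (n + 2) → k) (h : MvPolynomial (Fin (n + 2)) k) :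
    eval v h = (((lastEquiv k n h).map (eval fun i => v i.castSucc)).eval
      (v (Fin.last (n + 1)))) := by
  have h1 : eval v = ((Polynomial.evalRingHom (v (Fin.last (n + 1)))).comp
      (Polynomial.mapRingHom (eval fun i => v i.castSucc))).comp
        (lastEquiv k n).toRingEquiv.toRingHom := by
    refine MvPolynomial.ringHom_ext (fun c => ?_) fun i => ?_
    · simp
    · refine Fin.lastCases ?_ (fun j => ?_) i <;> simp
  exact RingHom.congr_fun h1 h

/-! ### Maps compatible with the projection from the center -/

/-- The form tuple `f` on `ℙⁿ⁺¹` is compatible with `g` on `ℙⁿ` under the projection from the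
center: the first `n + 1` entries of `f` are proportional to `g`. -/
def FormTuple.LiesOver (f : FormTuple k (n + 1)) (g : FormTuple k n) : Prop :=
  ∀ i j, f.form (Fin.castSucc i) * lift (g.form j) = f.form (Fin.castSucc j) * lift (g.form i)

theorem FormTuple.LiesOver.congr {f f' : FormTuple k (n + 1)} {g g' : FormTuple k n}
    (hf : f ≈ f') (hg : g ≈ g') (h : f.LiesOver g) : f'.LiesOver g' := by
  intro i j
  have h1 : lift (g.form i) * lift (g'.form 0) = lift (g.form 0) * lift (g'.form i) := by
    rw [← lift_mul, ← lift_mul, hg i 0]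
  have h2 : lift (g.form j) * lift (g'.form 0) = lift (g.form 0) * lift (g'.form j) := by
    rw [← lift_mul, ← lift_mul, hg j 0]
  have h3 := hf (Fin.castSucc i) (Fin.castSucc 0)
  have h4 := hf (Fin.castSucc j) (Fin.castSucc 0)
  have h5 := h i j
  apply mul_left_cancel₀ (mul_ne_zero (f.form_ne_zero (Fin.castSucc 0))
    (lift_ne_zero (g.form_ne_zero 0)))
  linear_combination f'.form (Fin.castSucc 0) * (- f.form (Fin.castSucc i) * h2
    + f.form (Fin.castSucc j) * h1 + lift (g'.form 0) * h5)
    - lift (g.form 0) * lift (g'.form j) * h3 + lift (g.form 0) * lift (g'.form i) * h4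

theorem FormTuple.LiesOver.comp {f f' : FormTuple k (n + 1)} {g g' : FormTuple k n}
    (h : f.LiesOver g) (h' : f'.LiesOver g') : (f.comp f').LiesOver (g.comp g') := by
  intro i j
  obtain ⟨e, he, hg⟩ := g.exists_degree
  have key : ∀ j, lift (g'.form 0) ^ e * bind₁ f'.form (lift (g.form j)) =
      f'.form (Fin.castSucc 0) ^ e * lift (bind₁ g'.form (g.form j)) := by
    intro j
    rw [bind₁_lift, lift_bind₁, ← bind₁_mul_left (hg j), ← bind₁_mul_left (hg j)]
    congr 2
    funext i
    rw [mul_comm]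
    exact h' i 0
  have h1 : bind₁ f'.form (f.form (Fin.castSucc i)) * bind₁ f'.form (lift (g.form j)) =
      bind₁ f'.form (f.form (Fin.castSucc j)) * bind₁ f'.form (lift (g.form i)) := by
    rw [← map_mul, ← map_mul, h i j]
  apply mul_left_cancel₀ (pow_ne_zero e (f'.form_ne_zero (Fin.castSucc 0)))
  simp only [FormTuple.comp]
  linear_combination lift (g'.form 0) ^ e * h1
    - bind₁ f'.form (f.form (Fin.castSucc i)) * key j
    + bind₁ f'.form (f.form (Fin.castSucc j)) * key i

theorem FormTuple.LiesOver.equiv {f : FormTuple k (n + 1)} {g g' : FormTuple k n}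
    (h : f.LiesOver g) (h' : f.LiesOver g') : g ≈ g' := by
  intro i j
  apply lift_injective
  rw [lift_mul, lift_mul]
  apply mul_left_cancel₀ (mul_ne_zero (f.form_ne_zero (Fin.castSucc i))
    (f.form_ne_zero (Fin.castSucc j)))
  have h1 := h i j
  have h2 := h' i j
  linear_combination f.form (Fin.castSucc j) * lift (g.form i) * h2
    - f.form (Fin.castSucc j) * lift (g'.form i) * h1

theorem FormTuple.id_liesOver_id : (FormTuple.id k (n + 1)).LiesOver (FormTuple.id k n) := by
  intro i j
  simp only [FormTuple.id, lift_X]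
  exact mul_comm _ _

theorem RatMap.mk_eq_mk {f g : FormTuple k n} :
    (Quotient.mk _ f : RatMap k n) = Quotient.mk _ g ↔ f ≈ g := Quotient.eq

/-- The rational map `F` of `ℙⁿ⁺¹` induces `G` under the projection from the center. -/
def RatMap.LiesOver (F : RatMap k (n + 1)) (G : RatMap k n) : Prop :=
  ∃ (f : FormTuple k (n + 1)) (g : FormTuple k n), (Quotient.mk _ f : RatMap k (n + 1)) = F ∧
    (Quotient.mk _ g : RatMap k n) = G ∧ f.LiesOver g

theorem RatMap.liesOver_mk {f : FormTuple k (n + 1)} {g : FormTuple k n} :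
    RatMap.LiesOver (Quotient.mk _ f) (Quotient.mk _ g) ↔ f.LiesOver g := by
  refine ⟨?_, fun h => ⟨f, g, rfl, rfl, h⟩⟩
  rintro ⟨f', g', hf, hg, h⟩
  exact h.congr (RatMap.mk_eq_mk.mp hf) (RatMap.mk_eq_mk.mp hg)

theorem RatMap.LiesOver.mul {F F' : RatMap k (n + 1)} {G G' : RatMap k n}
    (h : F.LiesOver G) (h' : F'.LiesOver G') : (F * F').LiesOver (G * G') := by
  obtain ⟨f, g, rfl, rfl, h⟩ := h
  obtain ⟨f', g', rfl, rfl, h'⟩ := h'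
  exact ⟨f.comp f', g.comp g', rfl, rfl, h.comp h'⟩

theorem RatMap.LiesOver.unique {F : RatMap k (n + 1)} {G G' : RatMap k n}
    (h : F.LiesOver G) (h' : F.LiesOver G') : G = G' := by
  obtain ⟨f, g, rfl, rfl, h⟩ := h
  obtain ⟨g', rfl⟩ := Quotient.exists_rep G'
  exact RatMap.mk_eq_mk.mpr (h.equiv (RatMap.liesOver_mk.mp h'))

theorem RatMap.one_liesOver_one : RatMap.LiesOver (1 : RatMap k (n + 1)) (1 : RatMap k n) :=
  ⟨_, _, rfl, rfl, FormTuple.id_liesOver_id⟩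

/-! ### Functions on the generic line through the center -/

/-- Constants as a ring homomorphism. -/
def constHom (k : Type*) [Field k] (n : ℕ) :
    MvPolynomial (Fin (n + 1)) k →+* RatFunc (Frac k n) :=
  RatFunc.C.comp (algebraMap _ (Frac k n))

theorem constHom_apply (p : MvPolynomial (Fin (n + 1)) k) : constHom k n p = const p := rfl

theorem constHom_injective : Function.Injective (constHom k n) :=
  RatFunc.C_injective.comp (IsFractionRing.injective _ _)

theorem const_ne_zero {p : MvPolynomial (Fin (n + 1)) k} (hp : p ≠ 0) : const p ≠ 0 := by
  rw [← constHom_apply, Ne, map_eq_zero_iff _ constHom_injective]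
  exact hp

/-- Substitution of polynomials `g` for `x₀, …, xₙ` and of a rational function `v` in the generic
fibre coordinate for the last variable. -/
def evalLast (g : Fin (n + 1) → MvPolynomial (Fin (n + 1)) k) (v : RatFunc (Frac k n)) :
    MvPolynomial (Fin (n + 2)) k →+* RatFunc (Frac k n) :=
  (Polynomial.eval₂RingHom ((constHom k n).comp (bind₁ g).toRingHom) v).comp
    (lastEquiv k n).toRingEquiv.toRingHom

theorem evalLast_apply (g : Fin (n + 1) → MvPolynomial (Fin (n + 1)) k) (v : RatFunc (Frac k n))
    (h : MvPolynomial (Fin (n + 2)) k) : evalLast g v h =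
      (lastEquiv k n h).eval₂ ((constHom k n).comp (bind₁ g).toRingHom) v := rfl

theorem evalLast_lift (g : Fin (n + 1) → MvPolynomial (Fin (n + 1)) k) (v : RatFunc (Frac k n))
    (p : MvPolynomial (Fin (n + 1)) k) : evalLast g v (lift p) = const (bind₁ g p) := by
  simp [evalLast_apply, constHom_apply]

@[simp] theorem evalLast_C (g : Fin (n + 1) → MvPolynomial (Fin (n + 1)) k)
    (v : RatFunc (Frac k n)) (c : k) : evalLast g v (C c) = const (C c) := by
  simp [evalLast_apply, constHom_apply]

@[simp] theorem evalLast_castSucc (g : Fin (n + 1) → MvPolynomial (Fin (n + 1)) k)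
    (v : RatFunc (Frac k n)) (i : Fin (n + 1)) :
    evalLast g v (X i.castSucc) = const (g i) := by
  rw [← lift_X, evalLast_lift, bind₁_X_right]

@[simp] theorem evalLast_last (g : Fin (n + 1) → MvPolynomial (Fin (n + 1)) k)
    (v : RatFunc (Frac k n)) : evalLast g v (X (Fin.last (n + 1))) = v := by
  simp [evalLast_apply]

theorem evalLast_eq_aeval (g : Fin (n + 1) → MvPolynomial (Fin (n + 1)) k)
    (v : RatFunc (Frac k n)) (h : MvPolynomial (Fin (n + 2)) k) :
    evalLast g v h = Polynomial.aeval v ((lastEquiv k n h).map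
      ((algebraMap _ (Frac k n)).comp (bind₁ g).toRingHom)) := by
  rw [evalLast_apply, Polynomial.aeval_def, Polynomial.eval₂_map]
  rfl

/-- The embedding of `k[x₀, …, xₙ₊₁]` in `k(x₀, …, xₙ)(t)`, with `t` the last variable. -/
def toRatFunc (k : Type*) [Field k] (n : ℕ) :
    MvPolynomial (Fin (n + 2)) k →+* RatFunc (Frac k n) := evalLast X RatFunc.X

theorem toRatFunc_eq (h : MvPolynomial (Fin (n + 2)) k) : toRatFunc k n h =
    algebraMap (Polynomial (Frac k n)) _
      ((lastEquiv k n h).map (algebraMap (MvPolynomial (Fin (n + 1)) k) (Frac k n))) := by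
  rw [toRatFunc, evalLast_eq_aeval, RatFunc.aeval_X_left_eq_algebraMap]
  congr 2
  refine MvPolynomial.ringHom_ext (fun c => ?_) fun i => ?_ <;> simp

theorem toRatFunc_injective : Function.Injective (toRatFunc k n) := by
  intro a b hab
  rw [toRatFunc_eq, toRatFunc_eq] at hab
  exact (lastEquiv k n).injective (Polynomial.map_injective _ (IsFractionRing.injective _ _)
    (RatFunc.algebraMap_injective _ hab))

theorem toRatFunc_ne_zero {h : MvPolynomial (Fin (n + 2)) k} (h0 : h ≠ 0) :
    toRatFunc k n h ≠ 0 := by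
  rwa [Ne, map_eq_zero_iff _ toRatFunc_injective]

@[simp] theorem toRatFunc_lift (p : MvPolynomial (Fin (n + 1)) k) :
    toRatFunc k n (lift p) = const p := by
  rw [toRatFunc, evalLast_lift, ← aeval_eq_bind₁, aeval_X_left_apply]

@[simp] theorem toRatFunc_last : toRatFunc k n (X (Fin.last (n + 1))) = RatFunc.X :=
  evalLast_last _ _

@[simp] theorem toRatFunc_castSucc (i : Fin (n + 1)) :
    toRatFunc k n (X i.castSucc) = const (X i) := evalLast_castSucc _ _ _

theorem toRatFunc_monoidForm (a b : MvPolynomial (Fin (n + 1)) k) :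
    toRatFunc k n (monoidForm a b) = const a * RatFunc.X + const b := by
  rw [monoidForm, map_add, map_mul, toRatFunc_lift, toRatFunc_lift, toRatFunc_last]

/-- Composition with a tuple, computed on the generic line through the center. -/
theorem toRatFunc_bind₁ {t : Fin (n + 2) → MvPolynomial (Fin (n + 2)) k}
    {g : Fin (n + 1) → MvPolynomial (Fin (n + 1)) k} {s v : RatFunc (Frac k n)}
    (h1 : ∀ i : Fin (n + 1), toRatFunc k n (t i.castSucc) = s * const (g i))
    (h2 : toRatFunc k n (t (Fin.last (n + 1))) = s * v)
    {h : MvPolynomial (Fin (n + 2)) k} {e : ℕ} (hh : h.IsHomogeneous e) :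
    toRatFunc k n (bind₁ t h) = s ^ e * evalLast g v h := by
  refine map_eq_pow_mul_map hh ((toRatFunc k n).comp (bind₁ t).toRingHom) (evalLast g v) s
    (fun c => ?_) fun i => ?_
  · simp [toRatFunc]
  · refine Fin.lastCases ?_ (fun j => ?_) i
    · simp [h2]
    · simp [h1]

/-- For `f` over `g`, the rational function `y` in the last variable for which `f` is the map
`(x, t) ↦ (g(x), y(x, t))`. -/
def fibreCoord (f : FormTuple k (n + 1)) (g : FormTuple k n) : RatFunc (Frac k n) :=
  toRatFunc k n (f.form (Fin.last (n + 1))) * const (g.form 0) /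
    toRatFunc k n (f.form (Fin.castSucc 0))

/-- The factor by which `f` differs from the normalized map `(x, t) ↦ (g(x), y(x, t))`. -/
def fibreScale (f : FormTuple k (n + 1)) (g : FormTuple k n) : RatFunc (Frac k n) :=
  toRatFunc k n (f.form (Fin.castSucc 0)) / const (g.form 0)

theorem fibreScale_ne_zero (f : FormTuple k (n + 1)) (g : FormTuple k n) :
    fibreScale f g ≠ 0 :=
  div_ne_zero (toRatFunc_ne_zero (f.form_ne_zero _)) (const_ne_zero (g.form_ne_zero 0))

theorem FormTuple.LiesOver.toRatFunc_bind₁ {f : FormTuple k (n + 1)} {g : FormTuple k n}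
    (hfg : f.LiesOver g) {h : MvPolynomial (Fin (n + 2)) k} {e : ℕ} (hh : h.IsHomogeneous e) :
    toRatFunc k n (bind₁ f.form h) = fibreScale f g ^ e * evalLast g.form (fibreCoord f g) h := by
  have hg := const_ne_zero (g.form_ne_zero 0)
  have hf := toRatFunc_ne_zero (f.form_ne_zero (Fin.castSucc 0))
  refine Cremona.toRatFunc_bind₁ (fun i => ?_) ?_ hh
  · have h1 := congrArg (toRatFunc k n) (hfg i 0)
    simp only [map_mul, toRatFunc_lift] at h1
    rw [fibreScale, div_mul_eq_mul_div, eq_div_iff hg, h1]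
  · rw [fibreScale, fibreCoord]
    field_simp

open IntermediateField in
/-- If `f` over `g` has a rational left inverse, then `t` is a rational function of the fibre
coordinate `y` of `f`. -/
theorem adjoin_fibreCoord_eq_top {f f' : FormTuple k (n + 1)} {g : FormTuple k n}
    (hfg : f.LiesOver g) (hf' : f'.comp f ≈ FormTuple.id k (n + 1)) :
    (Frac k n)⟮fibreCoord f g⟯ = ⊤ := by
  obtain ⟨d, hd, hfd⟩ := f'.exists_degree
  have hmem : ∀ h, evalLast g.form (fibreCoord f g) h ∈ (Frac k n)⟮fibreCoord f g⟯ := by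
    intro h
    rw [evalLast_eq_aeval]
    exact IntermediateField.algebra_adjoin_le_adjoin _ _
      (Polynomial.aeval_mem_adjoin_singleton _ _)
  have h0 : evalLast g.form (fibreCoord f g) (f'.form (Fin.castSucc 0)) ≠ 0 := by
    have h1 := toRatFunc_ne_zero ((f'.comp f).form_ne_zero (Fin.castSucc 0))
    rw [FormTuple.comp, hfg.toRatFunc_bind₁ (hfd _)] at h1
    exact right_ne_zero_of_mul h1
  have hx := congrArg (toRatFunc k n) (hf' (Fin.last (n + 1)) (Fin.castSucc 0))
  simp only [FormTuple.comp, FormTuple.id, map_mul, hfg.toRatFunc_bind₁ (hfd _),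
    toRatFunc_last, toRatFunc_castSucc] at hx
  have hX : RatFunc.X = evalLast g.form (fibreCoord f g) (f'.form (Fin.last (n + 1))) *
      const (X 0) / evalLast g.form (fibreCoord f g) (f'.form (Fin.castSucc 0)) := by
    rw [eq_div_iff h0]
    apply mul_left_cancel₀ (pow_ne_zero d (fibreScale_ne_zero f g))
    linear_combination -hx
  rw [← top_le_iff, ← RatFunc.adjoin_X, adjoin_simple_le_iff, hX]
  refine div_mem (mul_mem (hmem _) ?_) (hmem _)
  exact (IntermediateField.algebraMap_mem _ (algebraMap _ (Frac k n) (X 0)))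

open IntermediateField in
/-- The fibre coordinate of a left invertible map is not constant, since constants do not generate
the transcendental extension `k(x₀, …, xₙ)(t)`. -/
theorem fibreCoord_ne_C {f f' : FormTuple k (n + 1)} {g : FormTuple k n}
    (hfg : f.LiesOver g) (hf' : f'.comp f ≈ FormTuple.id k (n + 1)) :
    ¬ ∃ c, fibreCoord f g = RatFunc.C c := by
  rintro ⟨c, hc⟩
  have h1 := adjoin_fibreCoord_eq_top hfg hf'
  have h2 := RatFunc.finrank_eq_max_natDegree (fibreCoord f g)
  rw [h1, IntermediateField.finrank_top, hc] at h2
  simp at h2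

open IntermediateField in
theorem max_natDegree_fibreCoord {f f' : FormTuple k (n + 1)} {g : FormTuple k n}
    (hfg : f.LiesOver g) (hf' : f'.comp f ≈ FormTuple.id k (n + 1)) :
    max (fibreCoord f g).num.natDegree (fibreCoord f g).denom.natDegree = 1 := by
  rw [← RatFunc.finrank_eq_max_natDegree, adjoin_fibreCoord_eq_top hfg hf',
    IntermediateField.finrank_top]

/-! ### Inverses of maps compatible with the projection -/

/-- A tuple with a left inverse (up to a common factor) is dominant. -/
theorem bind₁_ne_zero_of_leftInverse {σ τ : Type*} {t : σ → MvPolynomial τ k}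
    (u : τ → MvPolynomial σ k) {p s : MvPolynomial σ k} (hs : s ≠ 0)
    (hu : ∀ i, p * bind₁ u (t i) = s * X i) {h : MvPolynomial σ k} {e : ℕ}
    (hh : h.IsHomogeneous e) (h0 : h ≠ 0) : bind₁ t h ≠ 0 := by
  intro hz
  have h1 : p ^ e * bind₁ u (bind₁ t h) = s ^ e * h := by
    rw [bind₁_bind₁, ← bind₁_mul_left hh]
    simp only [hu]
    rw [bind₁_mul_left hh, ← aeval_eq_bind₁, aeval_X_left_apply]
  rw [hz, map_zero, mul_zero] at h1
  exact mul_ne_zero (pow_ne_zero e hs) h0 h1.symm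

/-- A left inverse `f'` of a map `f` over `g` lies over a left inverse `g'` of `g`. Writing `f` as
`(x, t) ↦ (g(x), y)`, the polynomial `x₀ f'ᵢ(g, Y) - xᵢ f'₀(g, Y)` in `Y` has the root `y`, which is
transcendental over `k(x₀, …, xₙ)`; so it is zero, and `g'` can be read off from the coefficients of
a power of `Y` that occurs in `f'₀`. -/
theorem FormTuple.LiesOver.exists_leftInverse {f f' : FormTuple k (n + 1)} {g : FormTuple k n}
    (hfg : f.LiesOver g) (hf' : f'.comp f ≈ FormTuple.id k (n + 1)) :
    ∃ g' : FormTuple k n, f'.LiesOver g' ∧ g'.comp g ≈ FormTuple.id k n := by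
  obtain ⟨d, hd, hfd⟩ := f'.exists_degree
  have htr := RatFunc.transcendental_of_ne_C _ (fibreCoord_ne_C hfg hf')
  set r : MvPolynomial (Fin (n + 1)) k →+* MvPolynomial (Fin (n + 1)) k :=
    (bind₁ g.form).toRingHom with hr
  have hcoeff : ∀ (i : Fin (n + 1)) (l : ℕ),
      X 0 * bind₁ g.form ((lastEquiv k n (f'.form (Fin.castSucc i))).coeff l) =
        X i * bind₁ g.form ((lastEquiv k n (f'.form (Fin.castSucc 0))).coeff l) := by
    intro i l
    have hx := congrArg (toRatFunc k n) (hf' (Fin.castSucc i) (Fin.castSucc 0))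
    simp only [FormTuple.comp, FormTuple.id, map_mul, hfg.toRatFunc_bind₁ (hfd _),
      toRatFunc_castSucc] at hx
    have hx' : const (X 0) * evalLast g.form (fibreCoord f g) (f'.form (Fin.castSucc i)) =
        const (X i) * evalLast g.form (fibreCoord f g) (f'.form (Fin.castSucc 0)) := by
      apply mul_left_cancel₀ (pow_ne_zero d (fibreScale_ne_zero f g))
      linear_combination hx
    have hpoly : Polynomial.C (X 0) * (lastEquiv k n (f'.form (Fin.castSucc i))).map r -
        Polynomial.C (X i) * (lastEquiv k n (f'.form (Fin.castSucc 0))).map r = 0 := by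
      apply Polynomial.map_injective _ (IsFractionRing.injective _ (Frac k n))
      rw [Polynomial.map_zero]
      by_contra hne
      refine htr ⟨_, hne, ?_⟩
      simp only [evalLast_eq_aeval, ← hr, ← Polynomial.map_map] at hx'
      simp only [Polynomial.map_sub, Polynomial.map_mul, Polynomial.map_C, map_sub, map_mul,
        Polynomial.aeval_C]
      exact sub_eq_zero.mpr hx'
    have h2 := congrArg (fun p => Polynomial.coeff p l) (sub_eq_zero.mp hpoly)
    simp only [Polynomial.coeff_C_mul, Polynomial.coeff_map] at h2
    exact h2
  set l := (lastEquiv k n (f'.form (Fin.castSucc 0))).natDegree with hl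
  set b : Fin (n + 1) → MvPolynomial (Fin (n + 1)) k :=
    fun i => (lastEquiv k n (f'.form (Fin.castSucc i))).coeff l with hb
  have hb0 : b 0 ≠ 0 := by
    rw [hb, hl]
    refine Polynomial.leadingCoeff_ne_zero.mpr ?_
    rw [Ne, EmbeddingLike.map_eq_zero_iff]
    exact f'.form_ne_zero _
  have hld : l ≤ d := by
    by_contra hlt
    exact hb0 (coeff_lastEquiv_eq_zero (hfd _) (by omega))
  have hbh : ∀ i, (b i).IsHomogeneous (d - l) := fun i =>
    isHomogeneous_coeff_lastEquiv (hfd _) (by omega)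
  have hgb0 : bind₁ g.form (b 0) ≠ 0 := g.dominant _ _ (hbh 0) hb0
  have hu : ∀ i, X 0 * bind₁ g.form (X 0 * b i) = g.form 0 * bind₁ g.form (b 0) * X i := by
    intro i
    have h1 := hcoeff i l
    rw [map_mul, bind₁_X_right]
    linear_combination g.form 0 * h1
  let g' : FormTuple k n :=
    { form := fun i => X 0 * b i
      -- the factor `x₀` makes the degree positive
      exists_degree := ⟨1 + (d - l), by omega, fun i => (isHomogeneous_X k 0).mul (hbh i)⟩
      dominant := fun h e hh h0 => bind₁_ne_zero_of_leftInverse g.form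
        (mul_ne_zero (g.form_ne_zero 0) hgb0) hu hh h0 }
  have hg' : g'.comp g ≈ FormTuple.id k n := by
    intro i j
    apply mul_left_cancel₀ (X_ne_zero (R := k) (0 : Fin (n + 1)))
    change X 0 * (bind₁ g.form (X 0 * b i) * X j) = X 0 * (bind₁ g.form (X 0 * b j) * X i)
    linear_combination X j * hu i - X i * hu j
  refine ⟨g', fun i j => ?_, hg'⟩
  obtain ⟨e, he, hge⟩ := g'.exists_degree
  have hover : (f'.comp f).LiesOver (g'.comp g) :=
    FormTuple.id_liesOver_id.congr (Setoid.symm hf') (Setoid.symm hg')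
  have key : ∀ j, lift (g.form 0) ^ e * bind₁ f.form (lift (g'.form j)) =
      f.form (Fin.castSucc 0) ^ e * lift (bind₁ g.form (g'.form j)) := by
    intro j
    rw [bind₁_lift, lift_bind₁, ← bind₁_mul_left (hge j), ← bind₁_mul_left (hge j)]
    congr 2
    funext i
    rw [mul_comm]
    exact hfg i 0
  have hz : bind₁ f.form (f'.form (Fin.castSucc i) * lift (g'.form j) -
      f'.form (Fin.castSucc j) * lift (g'.form i)) = 0 := by
    have h1 := hover i j
    simp only [FormTuple.comp] at h1
    apply mul_left_cancel₀ (pow_ne_zero e (lift_ne_zero (g.form_ne_zero 0)))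
    rw [map_sub, map_mul, map_mul]
    linear_combination bind₁ f.form (f'.form (Fin.castSucc i)) * key j -
      bind₁ f.form (f'.form (Fin.castSucc j)) * key i + f.form (Fin.castSucc 0) ^ e * h1
  by_contra hne
  exact f.dominant _ (d + e) (((hfd _).mul (isHomogeneous_lift (hge j))).sub
    ((hfd _).mul (isHomogeneous_lift (hge i)))) (sub_ne_zero.mpr hne) hz

theorem RatMap.LiesOver.exists_inv {F : Cr k (n + 1)} {G : RatMap k n}
    (h : (F : RatMap k (n + 1)).LiesOver G) :
    ∃ G', ((F⁻¹ : Cr k (n + 1)) : RatMap k (n + 1)).LiesOver G' ∧ G' * G = 1 ∧ G * G' = 1 := by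
  obtain ⟨f, g, hf, rfl, hfg⟩ := h
  obtain ⟨f', hf'⟩ := Quotient.exists_rep ((F⁻¹ : Cr k (n + 1)) : RatMap k (n + 1))
  have hcomp : f'.comp f ≈ FormTuple.id k (n + 1) := by
    rw [← RatMap.mk_eq_mk]
    have := F.inv_mul
    rw [← hf, ← hf'] at this
    exact this
  obtain ⟨g', hg', hg⟩ := hfg.exists_leftInverse hcomp
  have h1 : ((F⁻¹ : Cr k (n + 1)) : RatMap k (n + 1)).LiesOver (Quotient.mk _ g') :=
    hf' ▸ RatMap.liesOver_mk.mpr hg'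
  have h0 : (F : RatMap k (n + 1)).LiesOver (Quotient.mk _ g) := hf ▸ RatMap.liesOver_mk.mpr hfg
  refine ⟨Quotient.mk _ g', h1, RatMap.mk_eq_mk.mpr hg, ?_⟩
  refine (h0.mul h1).unique ?_
  rw [F.mul_inv]
  exact RatMap.one_liesOver_one

/-- The Cremona maps of `ℙⁿ⁺¹` compatible with the projection from the center. -/
def projGroup (k : Type*) [Field k] (n : ℕ) : Subgroup (Cr k (n + 1)) where
  carrier := {F | ∃ G, (F : RatMap k (n + 1)).LiesOver G}
  mul_mem' := by
    rintro F F' ⟨G, h⟩ ⟨G', h'⟩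
    exact ⟨G * G', h.mul h'⟩
  one_mem' := ⟨1, RatMap.one_liesOver_one⟩
  inv_mem' := by
    rintro F ⟨G, h⟩
    obtain ⟨G', h', -⟩ := h.exists_inv
    exact ⟨G', h'⟩

theorem mem_projGroup {F : Cr k (n + 1)} :
    F ∈ projGroup k n ↔ ∃ G, (F : RatMap k (n + 1)).LiesOver G := Iff.rfl

theorem exists_induced (F : projGroup k n) :
    ∃ G : Cr k n, ((F : Cr k (n + 1)) : RatMap k (n + 1)).LiesOver G := by
  obtain ⟨G, h⟩ := mem_projGroup.mp F.2
  obtain ⟨G', -, h1, h2⟩ := h.exists_inv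
  exact ⟨⟨G, G', h2, h1⟩, h⟩

/-- The homomorphism sending a map to the map it induces on the lines through the center. -/
def inducedHom (k : Type*) [Field k] (n : ℕ) : projGroup k n →* Cr k n :=
  MonoidHom.mk' (fun F => (exists_induced F).choose) fun F F' =>
    Units.ext (RatMap.LiesOver.unique (exists_induced (F * F')).choose_spec
      ((exists_induced F).choose_spec.mul (exists_induced F').choose_spec))

theorem liesOver_inducedHom (F : projGroup k n) :
    ((F : Cr k (n + 1)) : RatMap k (n + 1)).LiesOver (inducedHom k n F : Cr k n) :=
  (exists_induced F).choose_spec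

theorem inducedHom_eq_iff {F : projGroup k n} {G : Cr k n} :
    inducedHom k n F = G ↔ ((F : Cr k (n + 1)) : RatMap k (n + 1)).LiesOver G :=
  ⟨fun h => h ▸ liesOver_inducedHom F, fun h =>
    Units.ext ((liesOver_inducedHom F).unique h)⟩

/-! ### The normal form -/

theorem coneTuple_castSucc (q f : MvPolynomial (Fin (n + 2)) k)
    (g : Fin (n + 1) → MvPolynomial (Fin (n + 1)) k) (i : Fin (n + 1)) :
    coneTuple q f g i.castSucc = q * lift (g i) := by
  simp [coneTuple]

theorem coneTuple_last (q f : MvPolynomial (Fin (n + 2)) k)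
    (g : Fin (n + 1) → MvPolynomial (Fin (n + 1)) k) :
    coneTuple q f g (Fin.last (n + 1)) = f := by
  simp [coneTuple]

theorem FormTuple.liesOver_of_coneTuple {t : FormTuple k (n + 1)} {g : FormTuple k n}
    {q f : MvPolynomial (Fin (n + 2)) k} (h : t.form = coneTuple q f g.form) : t.LiesOver g := by
  intro i j
  rw [h, coneTuple_castSucc, coneTuple_castSucc]
  ring

/-- A form of degree at most one in the last variable is a monoid, with coefficients of the expected
degrees. -/
theorem exists_eq_monoidForm {h : MvPolynomial (Fin (n + 2)) k} {e : ℕ} (hh : h.IsHomogeneous e)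
    (hdeg : (lastEquiv k n h).natDegree ≤ 1) : ∃ a b, IsFormOfDegree a ((e : ℤ) - 1) ∧
      IsFormOfDegree b e ∧ h = monoidForm a b := by
  refine ⟨(lastEquiv k n h).coeff 1, (lastEquiv k n h).coeff 0, ?_, ?_, ?_⟩
  · rcases Nat.eq_zero_or_pos e with rfl | he
    · exact Or.inl (coeff_lastEquiv_eq_zero hh Nat.one_pos)
    · exact Or.inr ⟨e - 1, by omega, isHomogeneous_coeff_lastEquiv hh (by omega)⟩
  · exact Or.inr ⟨e, rfl, isHomogeneous_coeff_lastEquiv hh (by omega)⟩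
  · apply (lastEquiv k n).injective
    rw [lastEquiv_monoidForm]
    exact Polynomial.eq_X_add_C_of_natDegree_le_one hdeg

theorem IsFormOfDegree.exists_isHomogeneous {a : MvPolynomial (Fin (n + 1)) k} {e : ℤ}
    (h : IsFormOfDegree a e) : ∃ e, a.IsHomogeneous e := by
  rcases h with rfl | ⟨m, -, h⟩
  · exact ⟨0, isHomogeneous_zero _ _ _⟩
  · exact ⟨m, h⟩

/-- A fraction of polynomials that is also a fraction of linear polynomials in the last variable
over the field `k(x₀, …, xₙ)`, is a fraction of linear ones over `k[x₀, …, xₙ]`. -/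
theorem exists_mul_monoidForm_eq {q p : MvPolynomial (Fin (n + 2)) k} (hq : q ≠ 0)
    (hmax : max (toRatFunc k n p / toRatFunc k n q).num.natDegree
      (toRatFunc k n p / toRatFunc k n q).denom.natDegree ≤ 1) :
    ∃ a b c d : MvPolynomial (Fin (n + 1)) k, monoidForm c d ≠ 0 ∧
      p * monoidForm c d = q * monoidForm a b := by
  classical
  set y := toRatFunc k n p / toRatFunc k n q with hy
  have hnum := Polynomial.eq_X_add_C_of_natDegree_le_one ((le_max_left _ _).trans hmax)
  have hden := Polynomial.eq_X_add_C_of_natDegree_le_one ((le_max_right _ _).trans hmax)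
  obtain ⟨r, hr⟩ := IsLocalization.exist_integer_multiples_of_finset
    (nonZeroDivisors (MvPolynomial (Fin (n + 1)) k))
    ({y.num.coeff 1, y.num.coeff 0, y.denom.coeff 1, y.denom.coeff 0} : Finset (Frac k n))
  obtain ⟨a, ha⟩ := hr (y.num.coeff 1) (by simp)
  obtain ⟨b, hb⟩ := hr (y.num.coeff 0) (by simp)
  obtain ⟨c, hc⟩ := hr (y.denom.coeff 1) (by simp)
  obtain ⟨d, hd⟩ := hr (y.denom.coeff 0) (by simp)
  have hr0 : (r : MvPolynomial (Fin (n + 1)) k) ≠ 0 := nonZeroDivisors.ne_zero r.2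
  rw [Algebra.smul_def] at ha hb hc hd
  have h1 : toRatFunc k n (monoidForm a b) = const r * algebraMap _ _ y.num := by
    rw [toRatFunc_monoidForm, hnum]
    simp only [const, ha, hb, map_mul, map_add, RatFunc.algebraMap_C, RatFunc.algebraMap_X]
    ring
  have h2 : toRatFunc k n (monoidForm c d) = const r * algebraMap _ _ y.denom := by
    rw [toRatFunc_monoidForm, hden]
    simp only [const, hc, hd, map_mul, map_add, RatFunc.algebraMap_C, RatFunc.algebraMap_X]
    ring
  have hD : algebraMap _ (RatFunc (Frac k n)) y.denom ≠ 0 :=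
    RatFunc.algebraMap_ne_zero y.denom_ne_zero
  refine ⟨a, b, c, d, fun h0 => ?_, ?_⟩
  · rw [h0, map_zero] at h2
    exact mul_ne_zero (const_ne_zero hr0) hD h2.symm
  · apply toRatFunc_injective
    rw [map_mul, map_mul, h1, h2]
    have h3 := (RatFunc.num_div_denom y).trans hy
    rw [div_eq_div_iff hD (toRatFunc_ne_zero hq)] at h3
    linear_combination -const (r : MvPolynomial (Fin (n + 1)) k) * h3

theorem natDegree_lastEquiv_le_one_of_dvd {h a b} (h0 : monoidForm a b ≠ 0)
    (hd : h ∣ monoidForm a b) : (lastEquiv k n h).natDegree ≤ 1 := by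
  have h1 := Polynomial.natDegree_le_of_dvd (map_dvd (lastEquiv k n) hd)
    ((EmbeddingLike.map_ne_zero_iff).mpr h0)
  rw [lastEquiv_monoidForm] at h1
  exact h1.trans Polynomial.natDegree_linear_le

/-- A tuple proportional to a dominant tuple is dominant. -/
theorem FormTuple.bind₁_ne_zero_of_mul_eq (f : FormTuple k n) {t : Fin (n + 1) → _}
    {p s : MvPolynomial (Fin (n + 1)) k} (hs : s ≠ 0)
    (ht : ∀ i, p * t i = s * f.form i) {h : MvPolynomial (Fin (n + 1)) k} {e : ℕ}
    (hh : h.IsHomogeneous e) (h0 : h ≠ 0) : bind₁ t h ≠ 0 := by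
  intro hz
  have h1 : p ^ e * bind₁ t h = s ^ e * bind₁ f.form h := by
    rw [← bind₁_mul_left hh, ← bind₁_mul_left hh]
    simp only [ht]
  rw [hz, mul_zero] at h1
  exact mul_ne_zero (pow_ne_zero e hs) (f.dominant h e hh h0) h1.symm

/-- A left invertible map over `g` is `(q g₀, …, q gₙ, p)` with coprime monoids `q` and `p`: its
fibre coordinate `p / q` generates `k(x₀, …, xₙ)(t)`, so it has degree one in `t`. -/
theorem FormTuple.LiesOver.exists_coneTuple {f f' : FormTuple k (n + 1)} {g : FormTuple k n}
    (hfg : f.LiesOver g) (hf' : f'.comp f ≈ FormTuple.id k (n + 1)) :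
    ∃ (q p : MvPolynomial (Fin (n + 2)) k) (e d : ℕ), (∀ i, (g.form i).IsHomogeneous d) ∧
      q.IsHomogeneous e ∧ p.IsHomogeneous (e + d) ∧ (lastEquiv k n q).natDegree ≤ 1 ∧
      (lastEquiv k n p).natDegree ≤ 1 ∧ IsRelPrime q p ∧
      (0 < (lastEquiv k n q).natDegree ∨ 0 < (lastEquiv k n p).natDegree) ∧
      ∃ t : FormTuple k (n + 1), t.form = coneTuple q p g.form ∧ t ≈ f := by
  obtain ⟨d, hd, hgd⟩ := g.exists_degree
  obtain ⟨m, hm, hfm⟩ := f.exists_degree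
  have hf0 := f.form_ne_zero (Fin.castSucc 0)
  have hg0 := lift_ne_zero (g.form_ne_zero 0)
  have hfl := f.form_ne_zero (Fin.last (n + 1))
  obtain ⟨q, p, c, hrel, hcq, hcp⟩ := UniqueFactorizationMonoid.exists_reduced_factors
    (f.form (Fin.castSucc 0)) hf0 (f.form (Fin.last (n + 1)) * lift (g.form 0))
  have hc0 : c ≠ 0 := left_ne_zero_of_mul (hcq ▸ hf0)
  have hq0 : q ≠ 0 := right_ne_zero_of_mul (hcq ▸ hf0)
  have hp0 : p ≠ 0 := right_ne_zero_of_mul (hcp ▸ mul_ne_zero hfl hg0)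
  have hcqh : (c * q).IsHomogeneous m := hcq ▸ hfm _
  have hcph : (c * p).IsHomogeneous (m + d) := hcp ▸ (hfm _).mul (isHomogeneous_lift (hgd 0))
  obtain ⟨u, hcu⟩ := exists_isHomogeneous_of_mul hcqh (mul_ne_zero hc0 hq0)
  obtain ⟨e, hqe⟩ := exists_isHomogeneous_of_mul (mul_comm c q ▸ hcqh) (mul_ne_zero hq0 hc0)
  obtain ⟨e', hpe⟩ := exists_isHomogeneous_of_mul (mul_comm c p ▸ hcph) (mul_ne_zero hp0 hc0)
  have he : u + e = m := (hcu.mul hqe).inj_right hcqh (mul_ne_zero hc0 hq0)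
  have he' : u + e' = m + d := (hcu.mul hpe).inj_right hcph (mul_ne_zero hc0 hp0)
  obtain rfl : e' = e + d := by omega
  have hy : fibreCoord f g = toRatFunc k n p / toRatFunc k n q := by
    rw [fibreCoord, ← toRatFunc_lift, ← map_mul, ← hcp, ← hcq, map_mul, map_mul,
      mul_div_mul_left _ _ (toRatFunc_ne_zero hc0)]
  obtain ⟨a, b, c', d', hcd, hmul⟩ := exists_mul_monoidForm_eq (p := p) hq0
    (hy ▸ (max_natDegree_fibreCoord hfg hf').le)
  have hab : monoidForm a b ≠ 0 := right_ne_zero_of_mul (hmul ▸ mul_ne_zero hp0 hcd)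
  have ht : ∀ i, c * coneTuple q p g.form i = lift (g.form 0) * f.form i := by
    intro i
    refine Fin.lastCases ?_ (fun j => ?_) i
    · rw [coneTuple_last, hcp, mul_comm]
    · rw [coneTuple_castSucc, ← mul_assoc, hcq, mul_comm (lift (g.form 0))]
      exact hfg 0 j
  refine ⟨q, p, e, d, hgd, hqe, hpe, natDegree_lastEquiv_le_one_of_dvd hcd ?_,
    natDegree_lastEquiv_le_one_of_dvd hab ?_, hrel, ?_, ?_⟩
  · exact hrel.dvd_of_dvd_mul_left (hmul ▸ dvd_mul_right _ _)
  · exact hrel.symm.dvd_of_dvd_mul_left (hmul ▸ dvd_mul_right _ _)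
  · by_contra hdeg
    simp only [not_or, not_lt, Nat.le_zero] at hdeg
    have h1 : ∀ h : MvPolynomial (Fin (n + 2)) k, (lastEquiv k n h).natDegree = 0 →
        ∃ r, toRatFunc k n h = RatFunc.C r := by
      intro h hh
      rw [toRatFunc_eq, Polynomial.eq_C_of_natDegree_eq_zero hh, Polynomial.map_C,
        RatFunc.algebraMap_C]
      exact ⟨_, rfl⟩
    obtain ⟨r, hr⟩ := h1 q hdeg.1
    obtain ⟨s, hs⟩ := h1 p hdeg.2
    exact fibreCoord_ne_C hfg hf' ⟨s / r, by rw [hy, hr, hs, map_div₀]⟩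
  · refine ⟨⟨coneTuple q p g.form, ⟨e + d, by omega, fun i => ?_⟩, fun h e' hh h0 =>
      f.bind₁_ne_zero_of_mul_eq hg0 ht hh h0⟩, rfl, fun i j => ?_⟩
    · refine Fin.lastCases ?_ (fun j => ?_) i
      · rwa [coneTuple_last]
      · rw [coneTuple_castSucc]
        exact hqe.mul (isHomogeneous_lift (hgd j))
    · apply mul_left_cancel₀ hc0
      linear_combination f.form j * ht i - f.form i * ht j

theorem RatMap.exists_leftInverse_tuple (F : Cr k n) {f : FormTuple k n}
    (hf : (Quotient.mk _ f : RatMap k n) = (F : RatMap k n)) : ∃ f' : FormTuple k n,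
      (Quotient.mk _ f' : RatMap k n) = ((F⁻¹ : Cr k n) : RatMap k n) ∧
        f'.comp f ≈ FormTuple.id k n ∧ f.comp f' ≈ FormTuple.id k n := by
  obtain ⟨f', hf'⟩ := Quotient.exists_rep ((F⁻¹ : Cr k n) : RatMap k n)
  refine ⟨f', hf', RatMap.mk_eq_mk.mp ?_, RatMap.mk_eq_mk.mp ?_⟩
  · have := F.inv_mul
    rw [← hf, ← hf'] at this
    exact this
  · have := F.mul_inv
    rw [← hf, ← hf'] at this
    exact this

theorem IsFormOfDegree.isLastMonoid {a b : MvPolynomial (Fin (n + 1)) k} {d e : ℤ} {m : ℕ}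
    (ha : IsFormOfDegree a d) (hb : IsFormOfDegree b e)
    (h : (monoidForm a b).IsHomogeneous m) : IsLastMonoid (monoidForm a b) :=
  ⟨⟨m, h⟩, a, b, ha.exists_isHomogeneous, hb.exists_isHomogeneous, rfl⟩

/-- The maps compatible with the projection from the center are those of the form
`(q g₀ : ⋯ : q gₙ : f)`. -/
theorem mem_projGroup_iff_exists_coneTuple (F : Cr k (n + 1)) : F ∈ projGroup k n ↔
    ∃ (g : Fin (n + 1) → MvPolynomial (Fin (n + 1)) k) (q f : MvPolynomial (Fin (n + 2)) k),
      (∃ G : Cr k n, (G : RatMap k n).HasForm g) ∧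
      IsLastMonoid q ∧ IsLastMonoid f ∧ IsRelPrime q f ∧
      (0 < q.degreeOf (Fin.last (n + 1)) ∨ 0 < f.degreeOf (Fin.last (n + 1))) ∧
      (F : RatMap k (n + 1)).HasForm (coneTuple q f g) := by
  constructor
  · intro hF
    obtain ⟨G, hG⟩ := exists_induced ⟨F, hF⟩
    obtain ⟨f, g, hf, hg, hfg⟩ := hG
    obtain ⟨f', -, hf', -⟩ := RatMap.exists_leftInverse_tuple F hf
    obtain ⟨q, p, e, d, -, hqe, hpe, hq1, hp1, hrel, hpos, t, ht, htf⟩ :=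
      hfg.exists_coneTuple hf'
    rw [natDegree_lastEquiv, natDegree_lastEquiv] at hpos
    obtain ⟨a, b, ha, hb, rfl⟩ := exists_eq_monoidForm hqe hq1
    obtain ⟨a', b', ha', hb', rfl⟩ := exists_eq_monoidForm hpe hp1
    exact ⟨g.form, _, _, ⟨G, g, rfl, hg⟩, ha.isLastMonoid hb hqe, ha'.isLastMonoid hb' hpe, hrel,
      hpos, t, ht, (RatMap.mk_eq_mk.mpr htf).trans hf⟩
  · rintro ⟨_, q, f, ⟨G, g, rfl, hg⟩, -, -, -, -, t, ht, hF⟩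
    exact ⟨G, t, g, hF, hg, FormTuple.liesOver_of_coneTuple ht⟩

/-! ### Points and values of rational maps -/

/-- The values of the entries of a tuple at a vector. -/
def FormTuple.val (f : FormTuple k n) (v : Fin (n + 1) → k) : Fin (n + 1) → k :=
  fun i => eval v (f.form i)

theorem FormTuple.val_smul (f : FormTuple k n) : ∃ d : ℕ, 1 ≤ d ∧
    ∀ (c : k) (v : Fin (n + 1) → k), f.val (c • v) = c ^ d • f.val v := by
  obtain ⟨d, hd, hf⟩ := f.exists_degree
  exact ⟨d, hd, fun c v => funext fun i => eval_smul_of_isHomogeneous (hf i) c v⟩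

theorem eval_bind₁_form (f : FormTuple k n) (v : Fin (n + 1) → k)
    (h : MvPolynomial (Fin (n + 1)) k) : eval v (bind₁ f.form h) = eval (f.val v) h := by
  have h1 : (eval v).comp (bind₁ f.form).toRingHom = eval (f.val v) :=
    MvPolynomial.ringHom_ext (fun c => by simp) fun i => by simp [FormTuple.val]
  exact RingHom.congr_fun h1 h

theorem isHomogeneous_bind₁ {σ τ : Type*} {g : σ → MvPolynomial τ k} {d e : ℕ}
    (hg : ∀ i, (g i).IsHomogeneous d) {h : MvPolynomial σ k} (hh : h.IsHomogeneous e) :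
    (bind₁ g h).IsHomogeneous (d * e) := hh.aeval _ hg

theorem exists_rep_mk (v : Fin (n + 1) → k) (hv : v ≠ 0) :
    ∃ c : k, c ≠ 0 ∧ (Projectivization.mk k v hv).rep = c • v := by
  obtain ⟨a, ha⟩ := Projectivization.exists_smul_eq_mk_rep k v hv
  exact ⟨a, a.ne_zero, ha.symm⟩

theorem mk_eq_mk_of_proportional {v w : Fin (n + 1) → k} (hv : v ≠ 0) (hw : w ≠ 0)
    (h : ∀ i j, v i * w j = v j * w i) :
    Projectivization.mk k v hv = Projectivization.mk k w hw := by
  obtain ⟨j, hj⟩ := Function.ne_iff.mp hw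
  rw [Projectivization.mk_eq_mk_iff']
  refine ⟨v j / w j, funext fun i => ?_⟩
  simp only [Pi.smul_apply, smul_eq_mul, Pi.zero_apply] at hj ⊢
  rw [div_mul_eq_mul_div, div_eq_iff hj, h i j]

theorem proportional_of_mk_eq_mk {v w : Fin (n + 1) → k} {hv : v ≠ 0} {hw : w ≠ 0}
    (h : Projectivization.mk k v hv = Projectivization.mk k w hw) (i j : Fin (n + 1)) :
    v i * w j = v j * w i := by
  obtain ⟨a, rfl⟩ := (Projectivization.mk_eq_mk_iff' _ _ _ _ _).mp h
  simp only [Pi.smul_apply, smul_eq_mul]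
  ring

theorem eval_rep_mk_eq_zero_iff {h : MvPolynomial (Fin (n + 1)) k} {e : ℕ}
    (hh : h.IsHomogeneous e) (v : Fin (n + 1) → k) (hv : v ≠ 0) :
    eval (Projectivization.mk k v hv).rep h = 0 ↔ eval v h = 0 := by
  obtain ⟨c, hc, hcv⟩ := exists_rep_mk v hv
  rw [hcv, eval_smul_of_isHomogeneous hh, mul_eq_zero, or_iff_right (pow_ne_zero e hc)]

theorem eval_eq_zero_iff_of_mk_eq {h : MvPolynomial (Fin (n + 1)) k} {e : ℕ}
    (hh : h.IsHomogeneous e) {v w : Fin (n + 1) → k} {hv : v ≠ 0} {hw : w ≠ 0}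
    (hvw : Projectivization.mk k v hv = Projectivization.mk k w hw) :
    eval v h = 0 ↔ eval w h = 0 := by
  rw [← eval_rep_mk_eq_zero_iff hh v hv, hvw, eval_rep_mk_eq_zero_iff hh]

theorem RatMap.sendsTo_mk (f : FormTuple k n) {v : Fin (n + 1) → k} (hv : v ≠ 0)
    (hf : f.val v ≠ 0) : RatMap.SendsTo (Quotient.mk _ f) (Projectivization.mk k v hv)
      (Projectivization.mk k (f.val v) hf) := by
  obtain ⟨c, hc, hcv⟩ := exists_rep_mk v hv
  obtain ⟨d, -, hd⟩ := f.val_smul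
  have h1 : f.val (Projectivization.mk k v hv).rep = c ^ d • f.val v := by rw [hcv, hd]
  have h2 : f.val (Projectivization.mk k v hv).rep ≠ 0 := by
    rw [h1]
    exact smul_ne_zero (pow_ne_zero d hc) hf
  refine ⟨f, h2, rfl, ?_⟩
  refine mk_eq_mk_of_proportional hf h2 fun i j => ?_
  have h3 : ∀ i, f.val (Projectivization.mk k v hv).rep i = c ^ d * f.val v i :=
    fun i => congrFun h1 i
  change f.val v i * f.val _ j = f.val v j * f.val _ i
  rw [h3, h3]
  ring

/-- Any tuple representing a map is, where the map is defined, proportional to its value; the tuple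
may vanish there. -/
theorem RatMap.SendsTo.proportional {f : FormTuple k n} {v w : Fin (n + 1) → k} {hv : v ≠ 0}
    {hw : w ≠ 0} (h : RatMap.SendsTo (Quotient.mk _ f) (Projectivization.mk k v hv)
      (Projectivization.mk k w hw)) (i j : Fin (n + 1)) :
    f.val v i * w j = f.val v j * w i := by
  obtain ⟨f', h0, hf', hw'⟩ := h
  obtain ⟨c, hc, hcv⟩ := exists_rep_mk v hv
  obtain ⟨d, -, hd⟩ := f.val_smul
  have hff := RatMap.mk_eq_mk.mp hf'
  set r := (Projectivization.mk k v hv).rep with hr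
  have h1 : ∀ i j, f'.val r i * f.val r j = f'.val r j * f.val r i := by
    intro i j
    have := congrArg (eval r) (hff i j)
    rwa [map_mul, map_mul] at this
  have h2 : ∀ i j, w i * f'.val r j = w j * f'.val r i := fun i j =>
    proportional_of_mk_eq_mk hw' i j
  have h3 : ∀ i, f.val r i = c ^ d * f.val v i := fun i => by
    rw [hcv, hd]
    rfl
  obtain ⟨l, hl⟩ := Function.ne_iff.mp (show f'.val r ≠ 0 from h0)
  simp only [h3] at h1
  apply mul_left_cancel₀ (mul_ne_zero (pow_ne_zero d hc) (mul_ne_zero hl hl))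
  simp only [Pi.zero_apply] at hl
  linear_combination f'.val r l * w j * h1 l i - f'.val r l * w i * h1 l j
    + c ^ d * f'.val r l * (f.val v l * h2 j i)

theorem RatMap.SendsTo.eq_mk {f : FormTuple k n} {v : Fin (n + 1) → k} {hv : v ≠ 0}
    (hf : f.val v ≠ 0) {p' : Pts k n}
    (h : RatMap.SendsTo (Quotient.mk _ f) (Projectivization.mk k v hv) p') :
    p' = Projectivization.mk k (f.val v) hf := by
  induction p' using Projectivization.ind with | h w hw =>
  exact (mk_eq_mk_of_proportional hf hw h.proportional).symm

theorem RatMap.SendsTo.unique {F : RatMap k n} {p q q' : Pts k n} (h : F.SendsTo p q)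
    (h' : F.SendsTo p q') : q = q' := by
  obtain ⟨f, h0, rfl, rfl⟩ := h
  rw [← p.mk_rep] at h'
  exact (h'.eq_mk h0).symm

/-! ### Zariski open sets -/

/-- The points where a form does not vanish. -/
def basicOpen (u : MvPolynomial (Fin (n + 1)) k) : Set (Pts k n) := {p | eval p.rep u ≠ 0}

theorem mk_mem_basicOpen {u : MvPolynomial (Fin (n + 1)) k} {e : ℕ} (hu : u.IsHomogeneous e)
    {v : Fin (n + 1) → k} (hv : v ≠ 0) :
    Projectivization.mk k v hv ∈ basicOpen u ↔ eval v u ≠ 0 :=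
  (eval_rep_mk_eq_zero_iff hu v hv).not

theorem isZariskiOpen_basicOpen {u : MvPolynomial (Fin (n + 1)) k} {e : ℕ}
    (hu : u.IsHomogeneous e) : IsZariskiOpen (basicOpen u) := by
  refine ⟨{u}, fun f hf => ⟨e, hf ▸ hu⟩, ?_⟩
  ext p
  simp [basicOpen]

/-- A nonempty open set contains a nonempty basic open set: some defining form of the complement
does not vanish at a given point. -/
theorem exists_basicOpen_subset {U : Set (Pts k n)} (hU : IsZariskiOpen U) (h : U.Nonempty) :
    ∃ (u : MvPolynomial (Fin (n + 1)) k) (e : ℕ), u.IsHomogeneous e ∧ u ≠ 0 ∧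
      basicOpen u ⊆ U := by
  obtain ⟨S, hS, hUS⟩ := hU
  obtain ⟨p, hp⟩ := h
  have h1 : p ∉ Uᶜ := fun h => h hp
  rw [hUS] at h1
  simp only [Set.mem_ofPred_eq, not_forall] at h1
  obtain ⟨u, hu, h0⟩ := h1
  obtain ⟨e, he⟩ := hS u hu
  refine ⟨u, e, he, fun hz => h0 (by rw [hz, map_zero]), fun q hq => ?_⟩
  by_contra hqU
  have h2 : q ∈ Uᶜ := hqU
  rw [hUS] at h2
  exact hq (h2 u hu)

/-- A polynomial vanishing at all nonzero vectors of a nonempty basic open set is zero; leaving out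
the origin costs only the extra factor `x₀`. -/
theorem eq_zero_of_forall_eval [Infinite k] {h u : MvPolynomial (Fin (n + 1)) k} (hu : u ≠ 0)
    (hz : ∀ v, v ≠ 0 → eval v u ≠ 0 → eval v h = 0) : h = 0 := by
  have h1 : h * (u * X 0) = 0 := by
    apply MvPolynomial.funext
    intro v
    rw [map_mul, map_mul, map_zero, eval_X]
    by_contra hne
    have h2 := right_ne_zero_of_mul hne
    refine left_ne_zero_of_mul hne (hz v (fun h0 => right_ne_zero_of_mul h2 ?_)
      (left_ne_zero_of_mul h2))
    rw [h0, Pi.zero_apply]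
  exact (mul_eq_zero.mp h1).resolve_right (mul_ne_zero hu (X_ne_zero _))

theorem basicOpen_nonempty [Infinite k] {u : MvPolynomial (Fin (n + 1)) k} {e : ℕ}
    (hu : u.IsHomogeneous e) (h0 : u ≠ 0) : (basicOpen u).Nonempty := by
  by_contra hne
  rw [Set.not_nonempty_iff_eq_empty] at hne
  refine one_ne_zero (α := MvPolynomial (Fin (n + 1)) k)
    (eq_zero_of_forall_eval h0 fun v hv hvu => ?_)
  have h1 := (mk_mem_basicOpen hu hv).mpr hvu
  rw [hne] at h1
  exact h1.elim

/-- A Cremona map restricts to an isomorphism between basic open sets. On the locus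
`f₀ · f'₀(f) · u ≠ 0` neither `f` nor `f' ∘ f` vanishes, so `f'` undoes `f` there; the image is
described by the same conditions with `f` and `f'` exchanged and `u` pulled back by `f'`. -/
theorem biregularOn_basicOpen {f f' : FormTuple k n} (h1 : f'.comp f ≈ FormTuple.id k n)
    (h2 : f.comp f' ≈ FormTuple.id k n) {u : MvPolynomial (Fin (n + 1)) k} {e : ℕ}
    (hu : u.IsHomogeneous e) : RatMap.BiregularOn (Quotient.mk _ f)
      (basicOpen (f.form 0 * bind₁ f.form (f'.form 0) * u)) := by
  obtain ⟨d, hd, hfd⟩ := f.exists_degree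
  obtain ⟨d', hd', hfd'⟩ := f'.exists_degree
  have hW := ((hfd 0).mul (isHomogeneous_bind₁ hfd (hfd' 0))).mul hu
  have hW' := ((hfd' 0).mul (isHomogeneous_bind₁ hfd' (hfd 0))).mul (isHomogeneous_bind₁ hfd' hu)
  -- `f'` undoes `f` on points, whichever of the two maps comes first
  have hback : ∀ {f f' : FormTuple k n} (_ : f'.comp f ≈ FormTuple.id k n)
      {v : Fin (n + 1) → k} (hv : v ≠ 0) (hfv : f'.val (f.val v) ≠ 0),
      Projectivization.mk k (f'.val (f.val v)) hfv = Projectivization.mk k v hv := by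
    intro f f' h1 v hv hfv
    refine mk_eq_mk_of_proportional _ _ fun i j => ?_
    have h3 := congrArg (eval v) (h1 i j)
    simp only [FormTuple.comp, FormTuple.id, map_mul, eval_bind₁_form, eval_X] at h3
    exact h3
  have hmem : ∀ v (hv : v ≠ 0), Projectivization.mk k v hv ∈
      basicOpen (f.form 0 * bind₁ f.form (f'.form 0) * u) ↔
        (f.val v 0 ≠ 0 ∧ f'.val (f.val v) 0 ≠ 0) ∧ eval v u ≠ 0 := by
    intro v hv
    rw [mk_mem_basicOpen hW, map_mul, map_mul, eval_bind₁_form, mul_ne_zero_iff, mul_ne_zero_iff]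
    rfl
  have hmem' : ∀ w (hw : w ≠ 0), Projectivization.mk k w hw ∈
      basicOpen (f'.form 0 * bind₁ f'.form (f.form 0) * bind₁ f'.form u) ↔
        (f'.val w 0 ≠ 0 ∧ f.val (f'.val w) 0 ≠ 0) ∧ eval (f'.val w) u ≠ 0 := by
    intro v hv
    rw [mk_mem_basicOpen hW', map_mul, map_mul, eval_bind₁_form, eval_bind₁_form,
      mul_ne_zero_iff, mul_ne_zero_iff]
    rfl
  have hne : ∀ {w : Fin (n + 1) → k}, w 0 ≠ 0 → w ≠ 0 := by
    rintro w hw rfl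
    exact hw rfl
  refine ⟨fun p hp => ?_, ?_, Quotient.mk _ f', fun p hp p' hpp' => ?_⟩
  · induction p using Projectivization.ind with | h v hv =>
    rw [hmem] at hp
    exact ⟨_, RatMap.sendsTo_mk f hv (hne hp.1.1)⟩
  · convert! isZariskiOpen_basicOpen hW' using 1
    ext p'
    constructor
    · rintro ⟨p, hp, hpp'⟩
      induction p using Projectivization.ind with | h v hv =>
      rw [hmem] at hp
      obtain ⟨⟨ha, hb⟩, hc⟩ := hp
      obtain rfl := hpp'.eq_mk (hne ha)
      have hm := hback h1 hv (hne hb)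
      refine (hmem' _ _).mpr ⟨⟨hb, ?_⟩, ?_⟩
      · exact (eval_eq_zero_iff_of_mk_eq (hfd 0) hm).not.mpr ha
      · exact (eval_eq_zero_iff_of_mk_eq hu hm).not.mpr hc
    · intro hp'
      induction p' using Projectivization.ind with | h w hw =>
      obtain ⟨⟨ha, hb⟩, hc⟩ := (hmem' _ _).mp hp'
      have hm := hback h2 hw (hne hb)
      refine ⟨Projectivization.mk k (f'.val w) (hne ha), (hmem _ _).mpr ⟨⟨hb, ?_⟩, hc⟩, ?_⟩
      · exact (eval_eq_zero_iff_of_mk_eq (hfd' 0) hm).not.mpr ha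
      · rw [← hm]
        exact RatMap.sendsTo_mk f _ _
  · induction p using Projectivization.ind with | h v hv =>
    rw [hmem] at hp
    obtain ⟨⟨ha, hb⟩, hc⟩ := hp
    obtain rfl := hpp'.eq_mk (hne ha)
    rw [← hback h1 hv (hne hb)]
    exact RatMap.sendsTo_mk f' _ _

/-- A map is injective where it is biregular, so it keeps infinite sets infinite. -/
theorem RatMap.BiregularOn.infinite_image {F : RatMap k n} {U T : Set (Pts k n)}
    (hF : F.BiregularOn U) (hT : T ⊆ U) (hinf : T.Infinite) : (F.image T).Infinite := by
  obtain ⟨hdom, -, G, hG⟩ := hF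
  choose! φ hφ using fun p (hp : p ∈ U) => (hdom hp : ∃ p', F.SendsTo p p')
  have hinj : Set.InjOn φ T := by
    intro p hp q hq hpq
    have h1 := hG p (hT hp) _ (hφ p (hT hp))
    have h2 := hG q (hT hq) _ (hφ q (hT hq))
    rw [hpq] at h1
    exact h1.unique h2
  refine (hinf.image hinj).mono ?_
  rintro _ ⟨p, hp, rfl⟩
  exact ⟨p, hp, hφ p (hT hp)⟩

/-! ### Lines through the center -/

/-- The vector `(y, s)`. -/
def appendLast {R : Type*} {n : ℕ} (y : Fin (n + 1) → R) (s : R) : Fin (n + 2) → R :=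
  Fin.snoc (α := fun _ => R) y s

@[simp] theorem appendLast_castSucc {R : Type*} {n : ℕ} (y : Fin (n + 1) → R) (s : R)
    (i : Fin (n + 1)) : appendLast y s i.castSucc = y i := by simp [appendLast]

@[simp] theorem appendLast_last {R : Type*} {n : ℕ} (y : Fin (n + 1) → R) (s : R) :
    appendLast y s (Fin.last (n + 1)) = s := by simp [appendLast]

theorem appendLast_ne_zero {y : Fin (n + 1) → k} (hy : y ≠ 0) (s : k) : appendLast y s ≠ 0 := by
  intro h
  refine hy (funext fun i => ?_)
  rw [← appendLast_castSucc y s i, h]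
  rfl

theorem eval_appendLast (y : Fin (n + 1) → k) (s : k) (h : MvPolynomial (Fin (n + 2)) k) :
    eval (appendLast y s) h = ((lastEquiv k n h).map (eval y)).eval s := by
  rw [eval_eq_eval_lastEquiv]
  simp

theorem mk_appendLast_injective {y : Fin (n + 1) → k} (hy : y ≠ 0) : Function.Injective
    fun s => Projectivization.mk k (appendLast y s) (appendLast_ne_zero hy s) := by
  intro s s' h
  obtain ⟨i, hi⟩ := Function.ne_iff.mp hy
  have h1 := proportional_of_mk_eq_mk h i.castSucc (Fin.last (n + 1))
  simp only [appendLast_castSucc, appendLast_last] at h1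
  exact (mul_left_cancel₀ hi (h1.trans (mul_comm _ _))).symm

theorem mk_mem_lineThrough {y : Fin (n + 1) → k} (hy : y ≠ 0) {v : Fin (n + 2) → k}
    (hv : v ≠ 0) : Projectivization.mk k v hv ∈ lineThrough (Projectivization.mk k y hy) ↔
      ∀ i j : Fin (n + 1), v i.castSucc * y j = v j.castSucc * y i := by
  have h1 : Projectivization.mk k v hv ∈ lineThrough (Projectivization.mk k y hy) ↔
      ∃ a b : k, a • (Pi.single (Fin.last (n + 1)) 1 : Fin (n + 2) → k) +
        b • hyperplaneMap k n y = v := by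
    simp only [lineThrough, linearSubspace, toHyperplane, center, Set.mem_ofPred_eq,
      Projectivization.map_mk, Projectivization.submodule_mk,
      Submodule.span_singleton_le_iff_mem, Submodule.mem_sup, Submodule.mem_span_singleton]
    constructor
    · rintro ⟨_, ⟨a, rfl⟩, _, ⟨b, rfl⟩, h⟩
      exact ⟨a, b, h⟩
    · rintro ⟨a, b, h⟩
      exact ⟨_, ⟨a, rfl⟩, _, ⟨b, rfl⟩, h⟩
  rw [h1]
  constructor
  · rintro ⟨a, b, rfl⟩ i j
    simp [hyperplaneMap]
    ring
  · intro h
    obtain ⟨j, hj⟩ := Function.ne_iff.mp hy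
    refine ⟨v (Fin.last (n + 1)), v j.castSucc / y j, funext fun i => ?_⟩
    refine Fin.lastCases ?_ (fun i => ?_) i
    · simp [hyperplaneMap]
    · simp only [Pi.zero_apply] at hj
      simp [hyperplaneMap]
      rw [div_mul_eq_mul_div, div_eq_iff hj, h i j]

theorem mk_appendLast_mem_lineThrough {y : Fin (n + 1) → k} (hy : y ≠ 0) (s : k) :
    Projectivization.mk k (appendLast y s) (appendLast_ne_zero hy s) ∈
      lineThrough (Projectivization.mk k y hy) := by
  rw [mk_mem_lineThrough]
  intro i j
  simp only [appendLast_castSucc]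
  ring

theorem exists_eq_smul_of_mem_lineThrough {y : Fin (n + 1) → k} {hy : y ≠ 0}
    {v : Fin (n + 2) → k} {hv : v ≠ 0}
    (h : Projectivization.mk k v hv ∈ lineThrough (Projectivization.mk k y hy)) :
    ∃ b : k, (fun i : Fin (n + 1) => v i.castSucc) = b • y := by
  rw [mk_mem_lineThrough] at h
  obtain ⟨j, hj⟩ := Function.ne_iff.mp hy
  refine ⟨v j.castSucc / y j, funext fun i => ?_⟩
  simp only [Pi.zero_apply] at hj
  rw [Pi.smul_apply, smul_eq_mul, div_mul_eq_mul_div, eq_div_iff hj, h i j]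

/-- The points of a line through the center, other than the center. -/
theorem eq_mk_appendLast_of_mem_lineThrough {y : Fin (n + 1) → k} {hy : y ≠ 0}
    {v : Fin (n + 2) → k} {hv : v ≠ 0}
    (h : Projectivization.mk k v hv ∈ lineThrough (Projectivization.mk k y hy))
    (h0 : (fun i : Fin (n + 1) => v i.castSucc) ≠ 0) : ∃ s : k, Projectivization.mk k v hv =
      Projectivization.mk k (appendLast y s) (appendLast_ne_zero hy s) := by
  obtain ⟨b, hb⟩ := exists_eq_smul_of_mem_lineThrough h
  have hb0 : b ≠ 0 := by
    rintro rfl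
    exact h0 (hb.trans (zero_smul _ _))
  refine ⟨v (Fin.last (n + 1)) / b, (Projectivization.mk_eq_mk_iff' _ _ _ _ _).mpr
    ⟨b, funext fun i => ?_⟩⟩
  refine Fin.lastCases ?_ (fun i => ?_) i
  · simp [mul_div_cancel₀ _ hb0]
  · simpa using (congrFun hb i).symm

theorem lineThrough_injective : Function.Injective (lineThrough : Pts k n → _) := by
  intro y z h
  induction y using Projectivization.ind with | h y hy =>
  induction z using Projectivization.ind with | h z hz =>
  have h1 := mk_appendLast_mem_lineThrough hy 0
  rw [h, mk_mem_lineThrough] at h1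
  exact mk_eq_mk_of_proportional hy hz fun i j => by simpa using h1 i j

/-- The lines through the center are parametrized by their intersections with the hyperplane. -/
theorem mem_schubert_iff {L : Set (Pts k (n + 1))} :
    L ∈ schubert (center k n) 1 ↔ ∃ y : Pts k n, L = lineThrough y := by
  have hrank : ∀ y : Pts k n,
      Module.finrank k ((center k n).submodule ⊔ (toHyperplane y).submodule :
        Submodule k (Fin (n + 2) → k)) = 2 := by
    intro y
    have h1 := Submodule.finrank_sup_add_finrank_inf_eq (center k n).submodule
      (toHyperplane y).submodule
    have h2 : (center k n).submodule ⊓ (toHyperplane y).submodule = ⊥ := by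
      induction y using Projectivization.ind with | h y hy =>
      rw [Submodule.eq_bot_iff]
      rintro v ⟨hv1, hv2⟩
      simp only [center, toHyperplane, Projectivization.map_mk, Projectivization.submodule_mk,
        SetLike.mem_coe, Submodule.mem_span_singleton] at hv1 hv2
      obtain ⟨a, rfl⟩ := hv1
      obtain ⟨b, hb⟩ := hv2
      have h3 := congrFun hb (Fin.last (n + 1))
      simp [hyperplaneMap] at h3
      rw [← h3, zero_smul]
    rw [h2, finrank_bot, Projectivization.finrank_submodule,
      Projectivization.finrank_submodule] at h1
    exact h1
  constructor
  · rintro ⟨W, hW, ho, rfl⟩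
    -- a vector of `W` outside the line spanned by the center
    obtain ⟨v, hvW, hv⟩ : ∃ v ∈ W, v ∉ (center k n).submodule := by
      by_contra! hle
      have h1 := Submodule.finrank_mono (R := k) (show W ≤ (center k n).submodule from hle)
      rw [hW, Projectivization.finrank_submodule] at h1
      omega
    have hy : (fun i : Fin (n + 1) => v i.castSucc) ≠ 0 := by
      intro h0
      apply hv
      rw [center, Projectivization.submodule_mk, Submodule.mem_span_singleton]
      refine ⟨v (Fin.last (n + 1)), funext fun i => ?_⟩
      refine Fin.lastCases ?_ (fun i => ?_) i
      · simp
      · simpa using (congrFun h0 i).symm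
    refine ⟨Projectivization.mk k _ hy, ?_⟩
    have hle : (center k n).submodule ⊔ (toHyperplane (Projectivization.mk k _ hy)).submodule ≤
        W := by
      refine sup_le ho ?_
      rw [toHyperplane, Projectivization.map_mk, Projectivization.submodule_mk,
        Submodule.span_singleton_le_iff_mem]
      have h1 : (Pi.single (Fin.last (n + 1)) 1 : Fin (n + 2) → k) ∈ W := by
        have := ho
        rwa [linearSubspace, Set.mem_ofPred_eq, center, Projectivization.submodule_mk,
          Submodule.span_singleton_le_iff_mem] at this
      have h2 : hyperplaneMap k n (fun i => v i.castSucc) =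
          v - v (Fin.last (n + 1)) • (Pi.single (Fin.last (n + 1)) 1 : Fin (n + 2) → k) := by
        funext i
        refine Fin.lastCases ?_ (fun i => ?_) i <;> simp [hyperplaneMap]
      rw [h2]
      exact W.sub_mem hvW (W.smul_mem _ h1)
    rw [lineThrough, Submodule.eq_of_le_of_finrank_eq hle ((hrank _).trans hW.symm)]
  · rintro ⟨y, rfl⟩
    refine ⟨_, hrank y, ?_, rfl⟩
    exact le_sup_left (a := (center k n).submodule)

/-- A form vanishing at all points `(y, s)` vanishes on the line through the center and `y`,
including the center: its coefficients at the powers of the last variable are forms that vanish at `y`, hence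
at every multiple of `y`. -/
theorem eval_eq_zero_of_mem_lineThrough {h : MvPolynomial (Fin (n + 2)) k} {e : ℕ}
    (hh : h.IsHomogeneous e) {y : Fin (n + 1) → k} {hy : y ≠ 0}
    (h0 : (lastEquiv k n h).map (eval y) = 0) {v : Fin (n + 2) → k} {hv : v ≠ 0}
    (hmem : Projectivization.mk k v hv ∈ lineThrough (Projectivization.mk k y hy)) :
    eval v h = 0 := by
  obtain ⟨b, hb⟩ := exists_eq_smul_of_mem_lineThrough hmem
  have h1 : (lastEquiv k n h).map (eval (b • y)) = 0 := by
    ext l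
    rw [Polynomial.coeff_map, Polynomial.coeff_zero]
    rcases le_or_gt l e with hl | hl
    · rw [eval_smul_of_isHomogeneous
        (isHomogeneous_coeff_lastEquiv hh (show l + (e - l) = e by omega)), ← Polynomial.coeff_map,
        h0, Polynomial.coeff_zero, mul_zero]
    · rw [coeff_lastEquiv_eq_zero hh hl, map_zero]
  rw [eval_eq_eval_lastEquiv, hb, h1, Polynomial.eval_zero]

theorem isZariskiClosed_lineThrough (y : Pts k n) : IsZariskiClosed (lineThrough y) := by
  induction y using Projectivization.ind with | h y hy =>
  refine ⟨{f | ∃ i j : Fin (n + 1), f = X i.castSucc * C (y j) - X j.castSucc * C (y i)}, ?_, ?_⟩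
  · rintro _ ⟨i, j, rfl⟩
    exact ⟨1, ((isHomogeneous_X k _).mul (isHomogeneous_C _ _)).sub
      ((isHomogeneous_X k _).mul (isHomogeneous_C _ _))⟩
  · ext p
    conv_lhs => rw [← p.mk_rep]
    rw [mk_mem_lineThrough]
    constructor
    · rintro h _ ⟨i, j, rfl⟩
      simp [h i j]
    · intro h i j
      have h1 := h _ ⟨i, j, rfl⟩
      simpa [sub_eq_zero] using h1

/-- An infinite set of points of a line through the center is dense in that line. -/
theorem zariskiClosure_eq_lineThrough {T : Set (Pts k (n + 1))} {y : Pts k n}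
    (hT : T ⊆ lineThrough y) (hinf : T.Infinite) : zariskiClosure T = lineThrough y := by
  refine Set.Subset.antisymm (Set.sInter_subset_of_mem ⟨isZariskiClosed_lineThrough y, hT⟩) ?_
  rintro p hp Z ⟨⟨S, hS, rfl⟩, hTZ⟩ f hf
  obtain ⟨e, he⟩ := hS f hf
  induction y using Projectivization.ind with | h y hy =>
  induction p using Projectivization.ind with | h v hv =>
  rw [eval_rep_mk_eq_zero_iff he]
  refine eval_eq_zero_of_mem_lineThrough he ?_ hp
  by_contra hne
  refine hinf (Set.Finite.subset (((lastEquiv k n f).map (eval y)).rootSet_finite k |>.image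
    (fun s => Projectivization.mk k (appendLast y s) (appendLast_ne_zero hy s)) |>.insert
      (center k n)) fun q hq => ?_)
  have hqZ := hTZ hq f hf
  have hqL := hT hq
  induction q using Projectivization.ind with | h w hw =>
  by_cases h0 : (fun i : Fin (n + 1) => w i.castSucc) = 0
  · refine Or.inl (mk_eq_mk_of_proportional _ _ fun i j => ?_)
    have h1 : ∀ i : Fin (n + 1), w i.castSucc = 0 := congrFun h0
    refine Fin.lastCases ?_ (fun i => ?_) i <;> refine Fin.lastCases ?_ (fun j => ?_) j <;>
      simp [h1]
  · obtain ⟨s, hs⟩ := eq_mk_appendLast_of_mem_lineThrough hqL h0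
    refine Or.inr ⟨s, ?_, hs.symm⟩
    rw [hs, eval_rep_mk_eq_zero_iff he, eval_appendLast] at hqZ
    rw [Polynomial.mem_rootSet]
    exact ⟨hne, by simpa [Polynomial.aeval_def] using hqZ⟩

/-! ### De Jonquières maps -/

theorem eq_zero_of_forall_eval_of_ne_zero {R : Type*} [CommRing R] [IsDomain R] [Infinite R]
    {P W : Polynomial R} (hW : W ≠ 0) (h : ∀ s, W.eval s ≠ 0 → P.eval s = 0) : P = 0 := by
  have h1 : P * W = 0 := by
    apply Polynomial.funext
    intro s
    rw [Polynomial.eval_mul, Polynomial.eval_zero]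
    by_contra hne
    exact left_ne_zero_of_mul hne (h s (right_ne_zero_of_mul hne))
  exact (mul_eq_zero.mp h1).resolve_right hW

/-- Wherever a map over `g` is defined, possibly only through another tuple and possibly at the
center itself, it sends the points of the line through the center and `y` to points of the line through the
center and `g(y)`. -/
theorem FormTuple.LiesOver.mem_lineThrough {f : FormTuple k (n + 1)} {g : FormTuple k n}
    (hfg : f.LiesOver g) {y : Fin (n + 1) → k} {hy : y ≠ 0} (hgy : g.val y ≠ 0)
    {p p' : Pts k (n + 1)} (hp : p ∈ lineThrough (Projectivization.mk k y hy))
    (h : RatMap.SendsTo (Quotient.mk _ f) p p') :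
    p' ∈ lineThrough (Projectivization.mk k (g.val y) hgy) := by
  obtain ⟨f', h0, hf', rfl⟩ := h
  have hfg' : f'.LiesOver g :=
    hfg.congr (Setoid.symm (RatMap.mk_eq_mk.mp hf')) (Setoid.refl g)
  obtain ⟨d, -, hfd⟩ := f'.exists_degree
  rw [mk_mem_lineThrough]
  intro i j
  have hhom :
      (C (g.val y j) * f'.form i.castSucc - C (g.val y i) * f'.form j.castSucc).IsHomogeneous d :=
    ((hfd _).C_mul _).sub ((hfd _).C_mul _)
  have h1 : (lastEquiv k n (C (g.val y j) * f'.form i.castSucc -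
      C (g.val y i) * f'.form j.castSucc)).map (eval y) = 0 := by
    have h2 := congrArg (fun p => (lastEquiv k n p).map (eval y)) (hfg' i j)
    simp only [map_mul, lastEquiv_lift, Polynomial.map_mul, Polynomial.map_C] at h2
    simp only [map_sub, map_mul, lastEquiv_C, Polynomial.map_sub, Polynomial.map_mul,
      Polynomial.map_C, eval_C, FormTuple.val]
    linear_combination h2
  have h3 := eval_eq_zero_of_mem_lineThrough hhom h1 (hv := p.rep_nonzero)
    (show Projectivization.mk k p.rep p.rep_nonzero ∈ _ by rwa [p.mk_rep])
  rw [map_sub, map_mul, map_mul, eval_C, eval_C] at h3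
  linear_combination h3

/-- A Cremona map over `G` is an isomorphism on a basic open set, and maps the lines through the
center meeting it onto dense subsets of the lines that `G` assigns to them. -/
theorem RatMap.LiesOver.exists_basicOpen [Infinite k] {F : Cr k (n + 1)} {G : RatMap k n}
    (h : (F : RatMap k (n + 1)).LiesOver G) :
    ∃ (W : MvPolynomial (Fin (n + 2)) k) (e : ℕ), W.IsHomogeneous e ∧ W ≠ 0 ∧
      (F : RatMap k (n + 1)).BiregularOn (basicOpen W) ∧
      ∀ y, (lineThrough y ∩ basicOpen W).Nonempty → ∃ z, G.SendsTo y z ∧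
        (F : RatMap k (n + 1)).image (lineThrough y) ⊆ lineThrough z ∧
        ((F : RatMap k (n + 1)).image (lineThrough y ∩ basicOpen W)).Infinite := by
  obtain ⟨f, g, hf, rfl, hfg⟩ := h
  obtain ⟨f', -, h1, h2⟩ := RatMap.exists_leftInverse_tuple F hf
  obtain ⟨d, hd, hgd⟩ := g.exists_degree
  obtain ⟨m, -, hfm⟩ := f.exists_degree
  obtain ⟨m', -, hfm'⟩ := f'.exists_degree
  -- the factor `g₀` keeps the center out of the open set and makes `g` defined at `y`
  obtain ⟨W, hWdef⟩ : ∃ W, W = f.form 0 * bind₁ f.form (f'.form 0) * lift (g.form 0) := ⟨_, rfl⟩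
  have hWh : W.IsHomogeneous (m + m * m' + d) := by
    rw [hWdef]
    exact ((hfm 0).mul (isHomogeneous_bind₁ hfm (hfm' 0))).mul (isHomogeneous_lift (hgd 0))
  have hW0 : W ≠ 0 := by
    rw [hWdef]
    exact mul_ne_zero (mul_ne_zero (f.form_ne_zero 0) ((f'.comp f).form_ne_zero 0))
      (lift_ne_zero (g.form_ne_zero 0))
  have hbi : (F : RatMap k (n + 1)).BiregularOn (basicOpen W) := by
    rw [hWdef, ← hf]
    exact biregularOn_basicOpen h1 h2 (isHomogeneous_lift (hgd 0))
  refine ⟨W, _, hWh, hW0, hbi, fun y hy => ?_⟩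
  induction y using Projectivization.ind with | h y hy0 =>
  obtain ⟨p, hpL, hpW⟩ := hy
  induction p using Projectivization.ind with | h v hv =>
  rw [mk_mem_basicOpen hWh] at hpW
  have hvg : eval (fun i : Fin (n + 1) => v i.castSucc) (g.form 0) ≠ 0 := by
    rw [hWdef, map_mul, eval_lift] at hpW
    exact right_ne_zero_of_mul hpW
  obtain ⟨b, hb⟩ := exists_eq_smul_of_mem_lineThrough hpL
  rw [hb, eval_smul_of_isHomogeneous (hgd 0)] at hvg
  have hgy : g.val y ≠ 0 := fun h0 => right_ne_zero_of_mul hvg (congrFun h0 0)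
  have hb0 : b ≠ 0 := by
    rintro rfl
    exact left_ne_zero_of_mul hvg (zero_pow (by omega))
  refine ⟨_, RatMap.sendsTo_mk g hy0 hgy, ?_, ?_⟩
  · rintro p' ⟨p, hp, hpp'⟩
    rw [← hf] at hpp'
    exact hfg.mem_lineThrough hgy hp hpp'
  · refine hbi.infinite_image Set.inter_subset_right ?_
    obtain ⟨s, hs⟩ := eq_mk_appendLast_of_mem_lineThrough hpL (hb ▸ smul_ne_zero hb0 hy0)
    have hP : (lastEquiv k n W).map (eval y) ≠ 0 := by
      intro h0
      apply (eval_eq_zero_iff_of_mk_eq hWh hs).not.mp hpW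
      rw [eval_appendLast, h0, Polynomial.eval_zero]
    have hfin : (((lastEquiv k n W).map (eval y)).rootSet k).Finite := Polynomial.rootSet_finite _ k
    refine ((hfin.infinite_compl).image
      ((mk_appendLast_injective hy0).injOn)).mono ?_
    rintro _ ⟨s, hs, rfl⟩
    refine ⟨mk_appendLast_mem_lineThrough hy0 s, (mk_mem_basicOpen hWh _).mpr ?_⟩
    rw [eval_appendLast]
    intro h0
    exact hs ((Polynomial.mem_rootSet).mpr ⟨hP, by simpa [Polynomial.aeval_def] using h0⟩)

/-- If the lines through the center are mapped to lines through the center, the first entries of a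
tuple are, on each line, proportional to constants; these are read off from the coefficients of a
power of the last variable. -/
theorem exists_liesOver_of_isDeJonquieres [Infinite k] {F : Cr k (n + 1)}
    (h : IsDeJonquieres 1 (center k n) F) : ∃ G, (F : RatMap k (n + 1)).LiesOver G := by
  obtain ⟨U, hUne, hUo, ⟨hdom, -⟩, hL⟩ := h
  obtain ⟨u, e, hue, hu0, huU⟩ := exists_basicOpen_subset hUo hUne
  obtain ⟨f, hf⟩ := Quotient.exists_rep (F : RatMap k (n + 1))
  obtain ⟨d, hd, hfd⟩ := f.exists_degree
  -- the values at two points of a general line have proportional first entries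
  have hpair : ∀ (y : Fin (n + 1) → k) (_ : y ≠ 0) (s s' : k), eval (appendLast y s) u ≠ 0 →
      eval (appendLast y s') u ≠ 0 → ∀ i j : Fin (n + 1),
      f.val (appendLast y s) i.castSucc * f.val (appendLast y s') j.castSucc =
        f.val (appendLast y s) j.castSucc * f.val (appendLast y s') i.castSucc := by
    intro y hy s s' hs hs' i j
    have hmem : ∀ s, eval (appendLast y s) u ≠ 0 →
        Projectivization.mk k (appendLast y s) (appendLast_ne_zero hy s) ∈
          lineThrough (Projectivization.mk k y hy) ∩ U := fun s hs =>
      ⟨mk_appendLast_mem_lineThrough hy s, huU ((mk_mem_basicOpen hue _).mpr hs)⟩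
    obtain ⟨z, hz⟩ := mem_schubert_iff.mp
      (hL _ (mem_schubert_iff.mpr ⟨_, rfl⟩) ⟨_, hmem s hs⟩)
    induction z using Projectivization.ind with | h z hz0 =>
    have hprop : ∀ s, eval (appendLast y s) u ≠ 0 → ∀ i j : Fin (n + 1),
        f.val (appendLast y s) i.castSucc * z j = f.val (appendLast y s) j.castSucc * z i := by
      intro s hs i j
      obtain ⟨q, hq⟩ := hdom (hmem s hs).2
      have hqz : q ∈ lineThrough (Projectivization.mk k z hz0) := by
        rw [← hz]
        exact Set.mem_sInter.mpr fun Z hZ => hZ.2 ⟨_, hmem s hs, hq⟩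
      induction q using Projectivization.ind with | h w hw =>
      rw [← hf] at hq
      rw [mk_mem_lineThrough] at hqz
      obtain ⟨l, hl⟩ := Function.ne_iff.mp hw
      simp only [Pi.zero_apply] at hl
      apply mul_right_cancel₀ hl
      have h1 := hq.proportional i.castSucc l
      have h2 := hq.proportional j.castSucc l
      linear_combination z j * h1 - z i * h2 + f.val (appendLast y s) l * hqz i j
    obtain ⟨l, hl⟩ := Function.ne_iff.mp hz0
    simp only [Pi.zero_apply] at hl
    apply mul_right_cancel₀ (mul_ne_zero hl hl)
    have h1 := hprop s hs i l
    have h2 := hprop s hs j l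
    have h3 := hprop s' hs' i l
    have h4 := hprop s' hs' j l
    linear_combination f.val (appendLast y s') j.castSucc * z l * h1 -
      f.val (appendLast y s') i.castSucc * z l * h2 +
      f.val (appendLast y s) l.castSucc * (z i * h4 - z j * h3)
  set l := (lastEquiv k n (f.form (Fin.castSucc 0))).natDegree with hl
  set b : Fin (n + 1) → MvPolynomial (Fin (n + 1)) k :=
    fun i => (lastEquiv k n (f.form (Fin.castSucc i))).coeff l with hb
  have hb0 : b 0 ≠ 0 := by
    rw [hb, hl]
    refine Polynomial.leadingCoeff_ne_zero.mpr ?_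
    rw [Ne, EmbeddingLike.map_eq_zero_iff]
    exact f.form_ne_zero _
  have hld : l ≤ d := by
    by_contra hlt
    exact hb0 (coeff_lastEquiv_eq_zero (hfd _) (by omega))
  have hbh : ∀ i, (b i).IsHomogeneous (d - l) := fun i =>
    isHomogeneous_coeff_lastEquiv (hfd _) (by omega)
  have hrel : ∀ i j : Fin (n + 1),
      f.form i.castSucc * lift (b j) = f.form j.castSucc * lift (b i) := by
    intro i j
    rw [← sub_eq_zero]
    refine eq_zero_of_forall_eval (mul_ne_zero hu0
      (X_ne_zero (R := k) (Fin.castSucc (0 : Fin (n + 1))))) fun v hv hvu => ?_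
    rw [map_mul, eval_X] at hvu
    set y : Fin (n + 1) → k := fun i => v i.castSucc with hy
    have hy0 : y ≠ 0 := fun h0 => right_ne_zero_of_mul hvu (congrFun h0 0)
    have hvy : v = appendLast y (v (Fin.last (n + 1))) := by
      funext i
      refine Fin.lastCases ?_ (fun i => ?_) i <;> simp [hy]
    have hvu' := left_ne_zero_of_mul hvu
    have hpoly : Polynomial.C (f.val v i.castSucc) *
        (lastEquiv k n (f.form j.castSucc)).map (eval y) -
        Polynomial.C (f.val v j.castSucc) *
        (lastEquiv k n (f.form i.castSucc)).map (eval y) = 0 := by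
      refine eq_zero_of_forall_eval_of_ne_zero (W := (lastEquiv k n u).map (eval y)) ?_ ?_
      · intro h0
        apply hvu'
        rw [eval_eq_eval_lastEquiv, ← hy, h0, Polynomial.eval_zero]
      · intro s hs
        rw [← eval_appendLast] at hs
        have h1 := hpair y hy0 (v (Fin.last (n + 1))) s (hvy ▸ hvu') hs i j
        rw [← hvy] at h1
        rw [Polynomial.eval_sub, Polynomial.eval_mul, Polynomial.eval_mul, Polynomial.eval_C,
          Polynomial.eval_C, ← eval_appendLast, ← eval_appendLast, sub_eq_zero]
        exact h1
    have h2 := congrArg (fun p => Polynomial.coeff p l) hpoly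
    simp only [Polynomial.coeff_sub, Polynomial.coeff_C_mul, Polynomial.coeff_map,
      Polynomial.coeff_zero] at h2
    rw [map_sub, map_mul, map_mul, eval_lift, eval_lift]
    exact h2
  let g : FormTuple k n :=
    { form := fun i => X 0 * b i
      -- the factor `x₀` makes the degree positive
      exists_degree := ⟨1 + (d - l), by omega, fun i => (isHomogeneous_X k 0).mul (hbh i)⟩
      dominant := by
        intro h e hh h0 hz
        have h1 : f.form (Fin.castSucc 0) ^ e * lift (bind₁ (fun i => X 0 * b i) h) =
            lift (X 0 * b 0) ^ e * bind₁ f.form (lift h) := by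
          rw [bind₁_lift, lift_bind₁, ← bind₁_mul_left hh, ← bind₁_mul_left hh]
          congr 2
          funext i
          rw [lift_mul, lift_mul]
          linear_combination -lift (X 0) * hrel i 0
        rw [hz, lift_zero, mul_zero] at h1
        exact mul_ne_zero (pow_ne_zero e (lift_ne_zero (mul_ne_zero (X_ne_zero _) hb0)))
          (f.dominant _ e (isHomogeneous_lift hh) (lift_ne_zero h0)) h1.symm }
  refine ⟨Quotient.mk _ g, f, g, hf, rfl, fun i j => ?_⟩
  change f.form i.castSucc * lift (X 0 * b j) = f.form j.castSucc * lift (X 0 * b i)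
  rw [lift_mul, lift_mul]
  linear_combination lift (X 0) * hrel i j

theorem mem_projGroup_iff_isDeJonquieres [Infinite k] (F : Cr k (n + 1)) :
    F ∈ projGroup k n ↔ IsDeJonquieres 1 (center k n) F := by
  refine ⟨?_, exists_liesOver_of_isDeJonquieres⟩
  rintro ⟨G, hG⟩
  obtain ⟨W, e, hWe, hW0, hbi, hW⟩ := hG.exists_basicOpen
  refine ⟨basicOpen W, basicOpen_nonempty hWe hW0, isZariskiOpen_basicOpen hWe, hbi,
    fun L hL hne => ?_⟩
  obtain ⟨y, rfl⟩ := mem_schubert_iff.mp hL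
  obtain ⟨z, -, hz, hinf⟩ := hW y hne
  refine mem_schubert_iff.mpr ⟨z, zariskiClosure_eq_lineThrough (Set.Subset.trans ?_ hz) hinf⟩
  rintro p' ⟨p, hp, hpp'⟩
  exact ⟨p, hp.1, hpp'⟩

/-- A map over the identity maps each line through the center that meets its domain of biregularity
densely into itself. -/
theorem fixesGeneralLine_of_liesOver_one [Infinite k] {F : Cr k (n + 1)}
    (hF : (F : RatMap k (n + 1)).LiesOver 1) : FixesGeneralLine F := by
  obtain ⟨W, e, hWe, hW0, hbi, hW⟩ := hF.exists_basicOpen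
  refine ⟨basicOpen W, basicOpen_nonempty hWe hW0, isZariskiOpen_basicOpen hWe, hbi,
    fun L hL hne => ?_⟩
  obtain ⟨y, rfl⟩ := mem_schubert_iff.mp hL
  obtain ⟨z, hyz, hz, hinf⟩ := hW y hne
  have h1 : RatMap.SendsTo (1 : RatMap k n) y y := by
    have h2 : (FormTuple.id k n).val y.rep = y.rep := funext fun i => eval_X i
    have h3 := RatMap.sendsTo_mk (FormTuple.id k n) y.rep_nonzero (by
      rw [h2]
      exact y.rep_nonzero)
    simp only [h2, y.mk_rep] at h3
    exact h3
  obtain rfl := hyz.unique h1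
  refine zariskiClosure_eq_lineThrough (Set.Subset.trans ?_ hz) hinf
  rintro p' ⟨p, hp, hpp'⟩
  exact ⟨p, hp.1, hpp'⟩

/-- A map over `G` induces `G` on the lines that meet the basic open set of `W`; these include the
lines on which a fixed nonzero coefficient of `W` does not vanish. -/
theorem inducesOnLines_of_liesOver [Infinite k] {F : Cr k (n + 1)} {G : Cr k n}
    (hF : (F : RatMap k (n + 1)).LiesOver G) : InducesOnLines F G := by
  obtain ⟨W, e, hWe, hW0, hbi, hW⟩ := hF.exists_basicOpen
  obtain ⟨l, hl⟩ : ∃ l, (lastEquiv k n W).coeff l ≠ 0 := by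
    by_contra! h0
    exact hW0 ((lastEquiv k n).injective ((Polynomial.ext h0).trans (map_zero _).symm))
  have hle : l ≤ e := by
    by_contra hlt
    exact hl (coeff_lastEquiv_eq_zero hWe (by omega))
  have hhom := isHomogeneous_coeff_lastEquiv hWe (show l + (e - l) = e by omega)
  refine ⟨basicOpen ((lastEquiv k n W).coeff l), basicOpen_nonempty hhom hl,
    isZariskiOpen_basicOpen hhom, fun y hy => ?_⟩
  have hne : (lineThrough y ∩ basicOpen W).Nonempty := by
    induction y using Projectivization.ind with | h y hy0 =>
    rw [mk_mem_basicOpen hhom] at hy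
    by_contra hemp
    refine one_ne_zero (α := Polynomial k) (eq_zero_of_forall_eval_of_ne_zero
      (W := (lastEquiv k n W).map (eval y)) (fun h0 => hy ?_) fun s hs => ?_)
    · rw [← Polynomial.coeff_map, h0, Polynomial.coeff_zero]
    · rw [← eval_appendLast] at hs
      exact (hemp ⟨_, mk_appendLast_mem_lineThrough hy0 s,
        (mk_mem_basicOpen hWe (appendLast_ne_zero hy0 s)).mpr hs⟩).elim
  obtain ⟨z, hyz, hz, hinf⟩ := hW y hne
  refine ⟨z, hyz, zariskiClosure_eq_lineThrough hz (hinf.mono ?_)⟩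
  rintro p' ⟨p, hp, hpp'⟩
  exact ⟨p, hp.1, hpp'⟩

/-- The induced map is unique, since two nonempty open sets of points of the hyperplane meet densely
and a line through the center determines its point there. -/
theorem InducesOnLines.unique [Infinite k] {F : Cr k (n + 1)} {G G' : Cr k n}
    (h : InducesOnLines F G) (h' : InducesOnLines F G') : G = G' := by
  obtain ⟨V, hVne, hVo, hV⟩ := h
  obtain ⟨V', hVne', hVo', hV'⟩ := h'
  obtain ⟨u, e, hue, hu0, huV⟩ := exists_basicOpen_subset hVo hVne
  obtain ⟨u', e', hue', hu0', huV'⟩ := exists_basicOpen_subset hVo' hVne'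
  obtain ⟨g, hg⟩ := Quotient.exists_rep (G : RatMap k n)
  obtain ⟨g', hg'⟩ := Quotient.exists_rep (G' : RatMap k n)
  apply Units.ext
  rw [← hg, ← hg']
  refine RatMap.mk_eq_mk.mpr fun i j => ?_
  rw [← sub_eq_zero]
  refine eq_zero_of_forall_eval (mul_ne_zero hu0 hu0') fun v hv hvu => ?_
  rw [map_mul] at hvu
  obtain ⟨z, hz, hFz⟩ := hV _ (huV ((mk_mem_basicOpen hue hv).mpr (left_ne_zero_of_mul hvu)))
  obtain ⟨z', hz', hFz'⟩ :=
    hV' _ (huV' ((mk_mem_basicOpen hue' hv).mpr (right_ne_zero_of_mul hvu)))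
  obtain rfl := lineThrough_injective (hFz.symm.trans hFz')
  rw [← hg] at hz
  rw [← hg'] at hz'
  induction z using Projectivization.ind with | h w hw =>
  obtain ⟨l, hl⟩ := Function.ne_iff.mp hw
  simp only [Pi.zero_apply] at hl
  have h1 := hz.proportional i l
  have h2 := hz.proportional j l
  have h3 := hz'.proportional i l
  have h4 := hz'.proportional j l
  rw [map_sub, map_mul, map_mul, sub_eq_zero]
  change g.val v i * g'.val v j = g.val v j * g'.val v i
  apply mul_right_cancel₀ (mul_ne_zero hl hl)
  linear_combination g'.val v j * w l * h1 - g'.val v i * w l * h2 +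
    g.val v l * (w i * h4 - w j * h3)

theorem inducesOnLines_iff [Infinite k] (F : projGroup k n) (G : Cr k n) :
    InducesOnLines (F : Cr k (n + 1)) G ↔ G = inducedHom k n F := by
  have h1 := inducesOnLines_of_liesOver (liesOver_inducedHom F)
  exact ⟨fun h => h.unique h1, fun h => h ▸ h1⟩

/-! ### The Möbius group -/

/-- Substitution of a transcendental function is a field homomorphism. -/
theorem exists_ringHom_compose {v : RatFunc (Frac k n)} (hv : ¬ ∃ c, v = RatFunc.C c) :
    ∃ σ : RatFunc (Frac k n) →+* RatFunc (Frac k n), (∀ u, compose u v = σ u) ∧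
      (∀ c, σ (RatFunc.C c) = RatFunc.C c) ∧ σ RatFunc.X = v ∧
      ∀ p : Polynomial (Frac k n), σ (algebraMap _ _ p) = Polynomial.aeval v p := by
  have htr := RatFunc.transcendental_of_ne_C v hv
  let σ : RatFunc (Frac k n) →+* RatFunc (Frac k n) :=
    (algebraMap _ (RatFunc (Frac k n))).comp
      (RatFunc.algEquivOfTranscendental v htr).toRingEquiv.toRingHom
  have h1 : ∀ u, compose u v = σ u := fun u =>
    (RatFunc.algEquivOfTranscendental_apply v htr u).symm
  refine ⟨σ, h1, fun c => ?_, ?_, fun p => ?_⟩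
  · rw [← h1, compose, RatFunc.eval_C]
  · rw [← h1, compose, RatFunc.eval_X]
  · rw [← h1, compose, RatFunc.eval_algebraMap]
    rfl

theorem compose_X (u : RatFunc (Frac k n)) : compose u RatFunc.X = u := by
  conv_rhs => rw [← RatFunc.num_div_denom u]
  rw [← RatFunc.aeval_X_left_eq_algebraMap, ← RatFunc.aeval_X_left_eq_algebraMap]
  rfl

/-- A linear polynomial in `t` over `k(x₀, …, xₙ)`, as an element of `k(x₀, …, xₙ)(t)`. -/
theorem linear_eq_algebraMap (a b : Frac k n) : RatFunc.C a * RatFunc.X + RatFunc.C b =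
    algebraMap (Polynomial (Frac k n)) _ (Polynomial.C a * Polynomial.X + Polynomial.C b) := by
  rw [map_add, map_mul, RatFunc.algebraMap_C, RatFunc.algebraMap_C, RatFunc.algebraMap_X]

theorem linear_inj {a b c d : Frac k n} (h : RatFunc.C a * RatFunc.X + RatFunc.C b =
    RatFunc.C c * RatFunc.X + RatFunc.C d) : a = c ∧ b = d := by
  rw [linear_eq_algebraMap, linear_eq_algebraMap] at h
  have h1 := RatFunc.algebraMap_injective _ h
  have h2 := congrArg (fun p => Polynomial.coeff p 1) h1
  have h3 := congrArg (fun p => Polynomial.coeff p 0) h1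
  simp at h2 h3
  exact ⟨h2, h3⟩

theorem linear_eq_X_mul_linear {a b c d : Frac k n} (h : RatFunc.C a * RatFunc.X + RatFunc.C b =
    RatFunc.X * (RatFunc.C c * RatFunc.X + RatFunc.C d)) : b = 0 ∧ a = d ∧ c = 0 := by
  rw [linear_eq_algebraMap, linear_eq_algebraMap, ← RatFunc.algebraMap_X, ← map_mul] at h
  have h1 := RatFunc.algebraMap_injective _ h
  have h2 := congrArg (fun p => Polynomial.coeff p 0) h1
  have h3 := congrArg (fun p => Polynomial.coeff p (0 + 1)) h1
  have h4 := congrArg (fun p => Polynomial.coeff p (1 + 1)) h1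
  simp only [Polynomial.coeff_X_mul] at h3 h4
  simp at h2 h3 h4
  exact ⟨h2, h3, h4.symm⟩

theorem linear_ne_zero {a b : Frac k n} (h : a ≠ 0 ∨ b ≠ 0) :
    RatFunc.C a * RatFunc.X + RatFunc.C b ≠ 0 := by
  intro h0
  have h1 : RatFunc.C a * RatFunc.X + RatFunc.C b =
      RatFunc.C 0 * RatFunc.X + RatFunc.C 0 := by rw [h0]; simp
  obtain ⟨ha, hb⟩ := linear_inj h1
  rcases h with h | h
  exacts [h ha, h hb]

/-- The first coordinate, as an element of `k(x₀, …, xₙ)`. -/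
def firstCoord (k : Type*) [Field k] (n : ℕ) : Frac k n :=
  algebraMap (MvPolynomial (Fin (n + 1)) k) _ (X 0)

theorem firstCoord_ne_zero : firstCoord k n ≠ 0 := by
  rw [firstCoord, Ne, FaithfulSMul.algebraMap_eq_zero_iff]
  exact X_ne_zero 0

/-- The Möbius function of a matrix, with the powers of `x₀` cleared. -/
theorem ofMatrix_eq (g : GL (Fin 2) (functionField k n)) : ofMatrix g =
    (RatFunc.C (firstCoord k n * (g 0 0 : Frac k n)) * RatFunc.X +
      RatFunc.C (firstCoord k n ^ 2 * (g 0 1 : Frac k n))) /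
    (RatFunc.C (g 1 0 : Frac k n) * RatFunc.X +
      RatFunc.C (firstCoord k n * (g 1 1 : Frac k n))) := by
  have h0 : const (X 0 : MvPolynomial (Fin (n + 1)) k) ≠ 0 := const_ne_zero (X_ne_zero 0)
  have h1 : ∀ a b : Frac k n, RatFunc.C a * (RatFunc.X / const (X 0)) + RatFunc.C b =
      (RatFunc.C a * RatFunc.X + const (X 0) * RatFunc.C b) / const (X 0) := by
    intro a b
    field_simp
  rw [ofMatrix, h1, h1, div_div_div_cancel_right₀ h0, ← mul_div_assoc]
  simp only [map_mul, map_pow]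
  change _ = (const (X 0) * _ * _ + const (X 0) ^ 2 * _) / (_ + const (X 0) * _)
  congr 1
  ring

theorem det_coe_ne_zero (g : GL (Fin 2) (functionField k n)) :
    (g 0 0 : Frac k n) * g 1 1 - g 0 1 * g 1 0 ≠ 0 := by
  have h2 : g.val.det ≠ 0 := (Matrix.isUnits_det_units g).ne_zero
  rw [Matrix.det_fin_two] at h2
  intro h
  exact h2 (Subtype.ext h)

theorem ofMatrix_denom_ne_zero (g : GL (Fin 2) (functionField k n)) :
    RatFunc.C (g 1 0 : Frac k n) * RatFunc.X +
      RatFunc.C (firstCoord k n * (g 1 1 : Frac k n)) ≠ 0 := by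
  apply linear_ne_zero
  by_contra! h
  have h2 := (mul_eq_zero.mp h.2).resolve_left firstCoord_ne_zero
  apply det_coe_ne_zero g
  rw [h.1, h2, mul_zero, mul_zero, sub_zero]

/-- A Möbius function of nonzero determinant is not constant. -/
theorem ofMatrix_ne_C (g : GL (Fin 2) (functionField k n)) : ¬ ∃ c, ofMatrix g = RatFunc.C c := by
  rintro ⟨c, hc⟩
  rw [ofMatrix_eq, div_eq_iff (ofMatrix_denom_ne_zero g), mul_add, ← mul_assoc, ← map_mul,
    ← map_mul] at hc
  obtain ⟨h1, h2⟩ := linear_inj hc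
  apply det_coe_ne_zero g
  apply mul_left_cancel₀ (pow_ne_zero 2 (firstCoord_ne_zero (k := k) (n := n)))
  linear_combination firstCoord k n * (g 1 1 : Frac k n) * h1 - (g 1 0 : Frac k n) * h2

theorem ofMatrix_mul (g h : GL (Fin 2) (functionField k n)) :
    ofMatrix (g * h) = compose (ofMatrix g) (ofMatrix h) := by
  obtain ⟨σ, hσ, hC, hX, -⟩ := exists_ringHom_compose (ofMatrix_ne_C h)
  have hN := ofMatrix_denom_ne_zero h
  have hD := ofMatrix_denom_ne_zero (g * h)
  have hgD : σ (RatFunc.C (g 1 0 : Frac k n) * RatFunc.X +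
      RatFunc.C (firstCoord k n * (g 1 1 : Frac k n))) ≠ 0 := by
    rw [Ne, map_eq_zero_iff σ σ.injective]
    exact ofMatrix_denom_ne_zero g
  rw [hσ, ofMatrix_eq g, map_div₀, ofMatrix_eq (g * h), div_eq_div_iff hD hgD]
  simp only [map_add, map_mul, hC, hX, map_pow]
  rw [ofMatrix_eq h]
  have hc : ∀ i j, ((g * h) i j : Frac k n) = g i 0 * h 0 j + g i 1 * h 1 j := by
    intro i j
    rw [Units.val_mul, Matrix.mul_apply, Fin.sum_univ_two]
    rfl
  simp only [hc, map_add, map_mul, map_pow] at hN ⊢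
  field_simp
  ring

/-- Exactly the scalar matrices give the identity function. -/
theorem ofMatrix_eq_X_iff (g : GL (Fin 2) (functionField k n)) :
    ofMatrix g = RatFunc.X ↔ Matrix.ProjGenLinGroup.mk g = 1 := by
  have hx := firstCoord_ne_zero (k := k) (n := n)
  rw [← Matrix.ProjGenLinGroup.mk_one, eq_comm (a := Matrix.ProjGenLinGroup.mk g),
    Matrix.ProjGenLinGroup.mk_eq_mk_iff]
  constructor
  · intro h
    rw [ofMatrix_eq, div_eq_iff (ofMatrix_denom_ne_zero g)] at h
    obtain ⟨h1, h2, h3⟩ := linear_eq_X_mul_linear h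
    have h01 : g 0 1 = 0 :=
      Subtype.ext ((mul_eq_zero.mp h1).resolve_left (pow_ne_zero 2 hx))
    have h11 : g 0 0 = g 1 1 := Subtype.ext (mul_left_cancel₀ hx h2)
    have h10 : g 1 0 = 0 := Subtype.ext h3
    have hu : (g 0 0 : functionField k n) ≠ 0 := by
      intro h0
      apply det_coe_ne_zero g
      rw [h01, h0]
      simp
    refine ⟨Units.mk0 _ hu, ?_⟩
    rw [one_mul]
    ext i j
    fin_cases i <;> fin_cases j <;> simp [h01, h11, h10, Matrix.GeneralLinearGroup.scalar]
  · rintro ⟨u, hu⟩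
    rw [one_mul] at hu
    subst hu
    have hu : (u : Frac k n) ≠ 0 := by simp
    rw [ofMatrix_eq]
    simp [Matrix.GeneralLinearGroup.scalar]
    have h1 : RatFunc.C (firstCoord k n) ≠ 0 := by simpa using hx
    have h2 : RatFunc.C (u : Frac k n) ≠ 0 := by rwa [Ne, map_eq_zero]
    field_simp

theorem ofMatrix_eq_iff (g h : GL (Fin 2) (functionField k n)) : ofMatrix g = ofMatrix h ↔
    Matrix.ProjGenLinGroup.mk g = Matrix.ProjGenLinGroup.mk h := by
  have h1 : ofMatrix (h⁻¹ * h) = RatFunc.X := by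
    rw [ofMatrix_eq_X_iff, inv_mul_cancel, map_one]
  constructor
  · intro hgh
    rw [ofMatrix_mul, ← hgh, ← ofMatrix_mul, ofMatrix_eq_X_iff, map_mul, map_inv] at h1
    exact (inv_mul_eq_one.mp h1).symm
  · intro hgh
    have h2 : ofMatrix (h⁻¹ * g) = RatFunc.X := by
      rw [ofMatrix_eq_X_iff, map_mul, hgh, map_inv, inv_mul_cancel]
    rw [show g = h * (h⁻¹ * g) by group, ofMatrix_mul, h2, compose_X]

/-! ### Admissible quadruples -/

theorem moebius_eq_div (a b c d : MvPolynomial (Fin (n + 1)) k) : moebius a b c d =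
    toRatFunc k n (monoidForm a b) / toRatFunc k n (monoidForm c d) := by
  rw [moebius, toRatFunc_monoidForm, toRatFunc_monoidForm]

theorem monoidForm_ne_zero {a b : MvPolynomial (Fin (n + 1)) k} (h : a ≠ 0 ∨ b ≠ 0) :
    monoidForm a b ≠ 0 := by
  intro h0
  have h1 := congrArg (lastEquiv k n) h0
  rw [lastEquiv_monoidForm, map_zero] at h1
  have h2 := congrArg (fun p => Polynomial.coeff p 1) h1
  have h3 := congrArg (fun p => Polynomial.coeff p 0) h1
  simp at h2 h3
  rcases h with h | h
  exacts [h h2, h h3]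

theorem isHomogeneous_monoidForm {a b : MvPolynomial (Fin (n + 1)) k} {e : ℕ}
    (ha : IsFormOfDegree a ((e : ℤ) - 1)) (hb : IsFormOfDegree b e) :
    (monoidForm a b).IsHomogeneous e := by
  refine IsHomogeneous.add ?_ ?_
  · rcases ha with rfl | ⟨m, hm, ha⟩
    · rw [lift_zero, zero_mul]
      exact isHomogeneous_zero _ _ _
    · obtain rfl : e = m + 1 := by omega
      exact (isHomogeneous_lift ha).mul (isHomogeneous_X k _)
  · rcases hb with rfl | ⟨m, hm, hb⟩
    · rw [lift_zero]
      exact isHomogeneous_zero _ _ _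
    · obtain rfl : e = m := by omega
      exact isHomogeneous_lift hb

theorem lift_det_eq (a b c d : MvPolynomial (Fin (n + 1)) k) :
    lift (a * d - b * c) = lift a * monoidForm c d - lift c * monoidForm a b := by
  simp only [monoidForm, lift, map_sub, map_mul]
  ring

theorem natDegree_monoidForm_of_ne_zero {a b : MvPolynomial (Fin (n + 1)) k} (ha : a ≠ 0) :
    (lastEquiv k n (monoidForm a b)).natDegree = 1 := by
  rw [lastEquiv_monoidForm, Polynomial.natDegree_linear ha]

theorem natDegree_eq_zero_of_dvd_lift {w : MvPolynomial (Fin (n + 2)) k}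
    {p : MvPolynomial (Fin (n + 1)) k} (hp : p ≠ 0) (h : w ∣ lift p) :
    (lastEquiv k n w).natDegree = 0 := by
  have h1 := Polynomial.natDegree_le_of_dvd (map_dvd (lastEquiv k n) h)
    ((EmbeddingLike.map_ne_zero_iff).mpr (lift_ne_zero hp))
  rw [lastEquiv_lift, Polynomial.natDegree_C] at h1
  omega

/-- Coprimality of `a t + b` and `c t + d` excludes `a d = b c`: otherwise the linear one of the two
would divide a constant. -/
theorem Admissible.det_ne_zero {a b c d : MvPolynomial (Fin (n + 1)) k}
    (h : Admissible a b c d) : a * d - b * c ≠ 0 := by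
  obtain ⟨-, hac, hrel⟩ := h
  intro h0
  have h1 := lift_det_eq a b c d
  rw [h0, lift_zero, eq_comm, sub_eq_zero] at h1
  rcases hac with ha | hc
  · have h2 : monoidForm a b ∣ lift a := hrel.dvd_of_dvd_mul_right (h1 ▸ dvd_mul_left _ _)
    have h3 := natDegree_eq_zero_of_dvd_lift ha h2
    rw [natDegree_monoidForm_of_ne_zero ha] at h3
    exact one_ne_zero h3
  · have h2 : monoidForm c d ∣ lift c := hrel.symm.dvd_of_dvd_mul_right (h1 ▸ dvd_mul_left _ _)
    have h3 := natDegree_eq_zero_of_dvd_lift hc h2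
    rw [natDegree_monoidForm_of_ne_zero hc] at h3
    exact one_ne_zero h3

/-- A fraction `(a t + b) / (c t + d)` of nonzero determinant reduces to an admissible one: the
greatest common divisor of numerator and denominator divides the determinant, so it is constant
in `t`. -/
theorem exists_admissible {a b c d : MvPolynomial (Fin (n + 1)) k} {r : ℤ} (hr : 1 ≤ r)
    (ha : IsFormOfDegree a (r - 1)) (hb : IsFormOfDegree b r) (hc : IsFormOfDegree c (r - 2))
    (hd : IsFormOfDegree d (r - 1)) (hdet : a * d - b * c ≠ 0) :
    moebius a b c d ∈ moebiusSet k n := by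
  obtain ⟨m, rfl⟩ : ∃ m : ℕ, r = m + 1 := ⟨(r - 1).toNat, by omega⟩
  have hP : (monoidForm a b).IsHomogeneous (m + 1) :=
    isHomogeneous_monoidForm (by push_cast; exact ha) (by push_cast; exact hb)
  have hQ : (monoidForm c d).IsHomogeneous m :=
    isHomogeneous_monoidForm (by convert! hc using 1; ring) (by convert! hd using 1; ring)
  have hP0 : monoidForm a b ≠ 0 := monoidForm_ne_zero (by
    by_contra! h
    exact hdet (by rw [h.1, h.2, zero_mul, zero_mul, sub_zero]))
  have hQ0 : monoidForm c d ≠ 0 := monoidForm_ne_zero (by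
    by_contra! h
    exact hdet (by rw [h.1, h.2, mul_zero, mul_zero, sub_zero]))
  obtain ⟨P, Q, w, hrel, hwP, hwQ⟩ := UniqueFactorizationMonoid.exists_reduced_factors _ hP0
    (monoidForm c d)
  have hw0 : w ≠ 0 := left_ne_zero_of_mul (hwP ▸ hP0)
  have hP0' : P ≠ 0 := right_ne_zero_of_mul (hwP ▸ hP0)
  have hQ0' : Q ≠ 0 := right_ne_zero_of_mul (hwQ ▸ hQ0)
  have hwdeg : (lastEquiv k n w).natDegree = 0 := by
    refine natDegree_eq_zero_of_dvd_lift hdet ?_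
    rw [lift_det_eq]
    exact dvd_sub ((Dvd.intro _ hwQ).mul_left _) ((Dvd.intro _ hwP).mul_left _)
  obtain ⟨ω, hω⟩ := exists_isHomogeneous_of_mul (hwP ▸ hP) (hwP ▸ hP0)
  obtain ⟨e, he⟩ := exists_isHomogeneous_of_mul (mul_comm w Q ▸ hwQ ▸ hQ) (mul_ne_zero hQ0' hw0)
  obtain ⟨e', he'⟩ := exists_isHomogeneous_of_mul (mul_comm w P ▸ hwP ▸ hP)
    (mul_ne_zero hP0' hw0)
  have h1 : ω + e = m := (hω.mul he).inj_right (hwQ ▸ hQ) (mul_ne_zero hw0 hQ0')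
  have h2 : ω + e' = m + 1 := (hω.mul he').inj_right (hwP ▸ hP) (mul_ne_zero hw0 hP0')
  obtain rfl : e' = e + 1 := by omega
  obtain ⟨a', b', ha', hb', rfl⟩ := exists_eq_monoidForm he'
    (natDegree_lastEquiv_le_one_of_dvd hP0 (Dvd.intro_left _ hwP))
  obtain ⟨c', d', hc', hd', rfl⟩ := exists_eq_monoidForm he
    (natDegree_lastEquiv_le_one_of_dvd hQ0 (Dvd.intro_left _ hwQ))
  refine ⟨a', b', c', d', ⟨⟨e + 1, by omega, ?_, ?_, ?_, ?_⟩, ?_, hrel⟩, ?_⟩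
  · exact_mod_cast ha'
  · exact_mod_cast hb'
  · convert! hc' using 1
    ring
  · convert! hd' using 1
    ring
  · by_contra! h
    obtain ⟨rfl, rfl⟩ := h
    have hz : ∀ a b b' : MvPolynomial (Fin (n + 1)) k,
        w * monoidForm 0 b' = monoidForm a b → a = 0 := by
      intro a b b' hab
      have h3 := congrArg (lastEquiv k n) hab
      rw [map_mul, lastEquiv_monoidForm, lastEquiv_monoidForm,
        Polynomial.eq_C_of_natDegree_eq_zero hwdeg, map_zero, zero_mul, zero_add, ← map_mul] at h3
      simpa using (congrArg (fun p => Polynomial.coeff p 1) h3).symm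
    exact hdet (by rw [hz _ _ _ hwP, hz _ _ _ hwQ, zero_mul, mul_zero, sub_zero])
  · rw [moebius_eq_div, moebius_eq_div, ← hwP, ← hwQ, map_mul, map_mul,
      mul_div_mul_left _ _ (toRatFunc_ne_zero hw0)]

/-- Multiplying the entries of a matrix by a common denominator `Q`, a form, turns its Möbius
function into one of a quadruple of forms. -/
theorem ofMatrix_mem (g : GL (Fin 2) (functionField k n)) : ofMatrix g ∈ moebiusSet k n := by
  have hdet := det_coe_ne_zero g
  obtain ⟨d₁, p₁, q₁, hp₁, hq₁, h₁, e₁⟩ := (g 0 0).2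
  obtain ⟨d₂, p₂, q₂, hp₂, hq₂, h₂, e₂⟩ := (g 0 1).2
  obtain ⟨d₃, p₃, q₃, hp₃, hq₃, h₃, e₃⟩ := (g 1 0).2
  obtain ⟨d₄, p₄, q₄, hp₄, hq₄, h₄, e₄⟩ := (g 1 1).2
  have hι : ∀ {p : MvPolynomial (Fin (n + 1)) k}, p ≠ 0 → algebraMap _ (Frac k n) p ≠ 0 :=
    fun hp => by simpa using hp
  have hX := isHomogeneous_X k (0 : Fin (n + 1))
  have hQ := hι (mul_ne_zero (mul_ne_zero (mul_ne_zero h₁ h₂) h₃) h₄)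
  have i₁ := hι h₁
  have i₂ := hι h₂
  have i₃ := hι h₃
  have i₄ := hι h₄
  set Q := algebraMap _ (Frac k n) (q₁ * q₂ * q₃ * q₄) with hQdef
  have ha : algebraMap _ (Frac k n) (X 0 * (p₁ * q₂ * q₃ * q₄)) =
      Q * (firstCoord k n * (g 0 0 : Frac k n)) := by
    rw [e₁, hQdef, firstCoord]
    simp only [map_mul]
    field_simp
  have hb : algebraMap _ (Frac k n) (X 0 ^ 2 * (q₁ * p₂ * q₃ * q₄)) =
      Q * (firstCoord k n ^ 2 * (g 0 1 : Frac k n)) := by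
    rw [e₂, hQdef, firstCoord]
    simp only [map_mul, map_pow]
    field_simp
  have hc : algebraMap _ (Frac k n) (q₁ * q₂ * p₃ * q₄) = Q * (g 1 0 : Frac k n) := by
    rw [e₃, hQdef]
    simp only [map_mul]
    field_simp
  have hd : algebraMap _ (Frac k n) (X 0 * (q₁ * q₂ * q₃ * p₄)) =
      Q * (firstCoord k n * (g 1 1 : Frac k n)) := by
    rw [e₄, hQdef, firstCoord]
    simp only [map_mul]
    field_simp
  have hmain : ofMatrix g = moebius (X 0 * (p₁ * q₂ * q₃ * q₄)) (X 0 ^ 2 * (q₁ * p₂ * q₃ * q₄))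
      (q₁ * q₂ * p₃ * q₄) (X 0 * (q₁ * q₂ * q₃ * p₄)) := by
    have hs : RatFunc.C Q ≠ 0 := by rwa [Ne, map_eq_zero]
    rw [ofMatrix_eq, ← mul_div_mul_left _ _ hs, moebius]
    simp only [const, ha, hb, hc, hd]
    simp only [map_mul (RatFunc.C) Q, mul_add, mul_assoc]
  rw [hmain]
  refine exists_admissible (r := (d₁ + d₂ + d₃ + d₄ : ℕ) + 2) (by omega)
    (Or.inr ⟨1 + (d₁ + d₂ + d₃ + d₄), by push_cast; ring, ?_⟩)
    (Or.inr ⟨1 * 2 + (d₁ + d₂ + d₃ + d₄), by push_cast; ring, ?_⟩)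
    (Or.inr ⟨d₁ + d₂ + d₃ + d₄, by push_cast; ring, ?_⟩)
    (Or.inr ⟨1 + (d₁ + d₂ + d₃ + d₄), by push_cast; ring, ?_⟩) ?_
  · exact hX.mul (((hp₁.mul hq₂).mul hq₃).mul hq₄)
  · exact (hX.pow 2).mul (((hq₁.mul hp₂).mul hq₃).mul hq₄)
  · exact ((hq₁.mul hq₂).mul hp₃).mul hq₄
  · exact hX.mul (((hq₁.mul hq₂).mul hq₃).mul hp₄)
  · intro h0
    apply hdet
    have h5 := congrArg (algebraMap _ (Frac k n)) h0
    rw [map_sub, map_mul _ (X 0 * (p₁ * q₂ * q₃ * q₄)), map_mul _ (X 0 ^ 2 * (q₁ * p₂ * q₃ * q₄)),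
      map_zero, ha, hb, hc, hd] at h5
    apply mul_left_cancel₀ (mul_ne_zero (pow_ne_zero 2 hQ)
      (pow_ne_zero 2 (firstCoord_ne_zero (k := k) (n := n))))
    linear_combination h5

/-- Dividing the entries of an admissible quadruple by powers of `x₀` gives a matrix over the function
field. -/
theorem exists_ofMatrix_eq {a b c d : MvPolynomial (Fin (n + 1)) k} (h : Admissible a b c d) :
    ∃ g : GL (Fin 2) (functionField k n), ofMatrix g = moebius a b c d := by
  have hdet := h.det_ne_zero
  obtain ⟨⟨r, hr, ha, hb, hc, hd⟩, -, -⟩ := h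
  obtain ⟨m, rfl⟩ : ∃ m : ℕ, r = m + 1 := ⟨(r - 1).toNat, by omega⟩
  have hform : ∀ {p : MvPolynomial (Fin (n + 1)) k} {e : ℤ} (_ : IsFormOfDegree p e) (j l : ℕ)
      (_ : e + l = j), ∃ u : functionField k n, firstCoord k n ^ j * (u : Frac k n) =
        firstCoord k n ^ l * algebraMap _ (Frac k n) p := by
    intro p e hp j l hj
    have hhom : (X 0 ^ l * p).IsHomogeneous j := by
      rcases hp with rfl | ⟨m, hm, hp⟩
      · rw [mul_zero]
        exact isHomogeneous_zero _ _ _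
      · have h1 := ((isHomogeneous_X k (0 : Fin (n + 1))).pow l).mul hp
        convert! h1 using 1
        omega
    refine ⟨⟨algebraMap _ (Frac k n) (X 0 ^ l * p) / algebraMap _ (Frac k n) (X 0 ^ j), j, _, _,
      hhom, ?_, pow_ne_zero j (X_ne_zero 0), rfl⟩, ?_⟩
    · simpa using (isHomogeneous_X k (0 : Fin (n + 1))).pow j
    · have := pow_ne_zero j (firstCoord_ne_zero (k := k) (n := n))
      simp only [map_mul, map_pow]
      change firstCoord k n ^ j * (firstCoord k n ^ l * _ / firstCoord k n ^ j) = _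
      field_simp
  obtain ⟨α, hα⟩ := hform ha m 0 (by push_cast; ring)
  obtain ⟨β, hβ⟩ := hform hb (m + 1) 0 (by push_cast; ring)
  obtain ⟨γ, hγ⟩ := hform hc m 1 (by push_cast; ring)
  obtain ⟨δ, hδ⟩ := hform hd m 0 (by push_cast; ring)
  have hx := firstCoord_ne_zero (k := k) (n := n)
  have hM : (!![α, β; γ, δ] : Matrix (Fin 2) (Fin 2) (functionField k n)).det ≠ 0 := by
    rw [Matrix.det_fin_two_of]
    intro h0
    apply hdet
    apply IsFractionRing.injective _ (Frac k n)
    have h1 : (α : Frac k n) * δ - β * γ = 0 := congrArg Subtype.val h0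
    apply mul_left_cancel₀ hx
    rw [map_sub, map_mul, map_mul, map_zero, mul_zero]
    simp only [pow_zero, one_mul, pow_one] at hα hβ hγ hδ
    rw [← hα, ← hβ, ← hδ]
    linear_combination (firstCoord k n ^ (2 * m + 1)) * h1 +
      (firstCoord k n ^ (m + 1)) * (β : Frac k n) * hγ
  refine ⟨Matrix.GeneralLinearGroup.mkOfDetNeZero _ hM, ?_⟩
  rw [ofMatrix_eq, moebius]
  have hxm : RatFunc.C (firstCoord k n ^ m) ≠ 0 := by
    rw [Ne, map_eq_zero]
    exact pow_ne_zero m hx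
  have hx1 : RatFunc.C (firstCoord k n) ≠ 0 := by simpa using hx
  rw [← mul_div_mul_left _ _ hxm, ← mul_div_mul_left (const a * RatFunc.X + const b) _ hx1]
  simp only [pow_zero, one_mul, pow_one] at hα hβ hγ hδ
  congr 1
  · simp only [mul_add, ← mul_assoc, const, ← map_mul]
    rw [← hα, ← hβ]
    change RatFunc.C (firstCoord k n ^ m * firstCoord k n * (α : Frac k n)) * RatFunc.X +
      RatFunc.C (firstCoord k n ^ m * firstCoord k n ^ 2 * (β : Frac k n)) = _
    ring_nf
  · simp only [mul_add, ← mul_assoc, const, ← map_mul]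
    rw [← hγ, ← hδ]
    change RatFunc.C (firstCoord k n ^ m * (γ : Frac k n)) * RatFunc.X +
      RatFunc.C (firstCoord k n ^ m * firstCoord k n * (δ : Frac k n)) = _
    ring_nf

/-! ### Maps that preserve the general line through the center -/

/-- A map preserving the general line through the center is determined by its fibre coordinate. -/
theorem FormTuple.LiesOver.fibreCoord_eq_iff {f f' : FormTuple k (n + 1)}
    (h : f.LiesOver (FormTuple.id k n)) (h' : f'.LiesOver (FormTuple.id k n)) :
    fibreCoord f (FormTuple.id k n) = fibreCoord f' (FormTuple.id k n) ↔ f ≈ f' := by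
  have hf := f.form_ne_zero (Fin.castSucc 0)
  have hf' := f'.form_ne_zero (Fin.castSucc 0)
  have hx : const (X 0 : MvPolynomial (Fin (n + 1)) k) ≠ 0 := const_ne_zero (X_ne_zero 0)
  have hiff : fibreCoord f (FormTuple.id k n) = fibreCoord f' (FormTuple.id k n) ↔
      f.form (Fin.last (n + 1)) * f'.form (Fin.castSucc 0) =
        f'.form (Fin.last (n + 1)) * f.form (Fin.castSucc 0) := by
    rw [fibreCoord, fibreCoord, div_eq_div_iff (toRatFunc_ne_zero hf) (toRatFunc_ne_zero hf'),
      ← toRatFunc_injective.eq_iff, map_mul, map_mul]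
    simp only [FormTuple.id]
    constructor
    · intro h
      apply mul_left_cancel₀ hx
      linear_combination h
    · intro h
      linear_combination const (X 0) * h
  rw [hiff]
  constructor
  · intro hl
    have key : ∀ i, f.form i * f'.form (Fin.castSucc 0) = f'.form i * f.form (Fin.castSucc 0) := by
      intro i
      refine Fin.lastCases hl (fun j => ?_) i
      have h1 := h j 0
      have h2 := h' j 0
      simp only [FormTuple.id, lift_X] at h1 h2
      apply mul_left_cancel₀ (X_ne_zero (R := k) (Fin.castSucc (0 : Fin (n + 1))))
      linear_combination f'.form (Fin.castSucc 0) * h1 - f.form (Fin.castSucc 0) * h2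
    intro i j
    apply mul_left_cancel₀ (mul_ne_zero hf hf')
    linear_combination f.form (Fin.castSucc 0) * f'.form j * key i -
      f.form (Fin.castSucc 0) * f'.form i * key j
  · intro hff
    rw [hff _ _, mul_comm]

/-- On maps preserving the general line through the center, composition of maps is composition of
fibre coordinates. -/
theorem FormTuple.LiesOver.fibreCoord_comp {f f' : FormTuple k (n + 1)}
    (h' : f'.LiesOver (FormTuple.id k n))
    (hv : ¬ ∃ c, fibreCoord f' (FormTuple.id k n) = RatFunc.C c) :
    fibreCoord (f.comp f') (FormTuple.id k n) =
      compose (fibreCoord f (FormTuple.id k n)) (fibreCoord f' (FormTuple.id k n)) := by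
  obtain ⟨σ, hσ, hC, -, hσp⟩ := exists_ringHom_compose hv
  obtain ⟨d, -, hd⟩ := f.exists_degree
  have h1 : ∀ p, evalLast (FormTuple.id k n).form (fibreCoord f' (FormTuple.id k n)) p =
      σ (toRatFunc k n p) := by
    intro p
    have h2 : (bind₁ (FormTuple.id k n).form).toRingHom =
        RingHom.id (MvPolynomial (Fin (n + 1)) k) :=
      MvPolynomial.ringHom_ext (fun c => by simp) fun i => by simp [FormTuple.id]
    rw [evalLast_eq_aeval, toRatFunc_eq, hσp, h2, RingHom.comp_id]
  have hs := pow_ne_zero d (fibreScale_ne_zero f' (FormTuple.id k n))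
  rw [hσ, fibreCoord, fibreCoord, FormTuple.comp, h'.toRatFunc_bind₁ (hd _),
    h'.toRatFunc_bind₁ (hd _), h1, h1, map_div₀, map_mul, mul_assoc, mul_div_mul_left _ _ hs]
  congr 2
  exact (hC _).symm

theorem fibreCoord_of_coneTuple {f : FormTuple k (n + 1)} {a b c d : MvPolynomial (Fin (n + 1)) k}
    (h : f.form = coneTuple (monoidForm c d) (monoidForm a b) X) :
    fibreCoord f (FormTuple.id k n) = moebius a b c d := by
  have hx : const (X 0 : MvPolynomial (Fin (n + 1)) k) ≠ 0 := const_ne_zero (X_ne_zero 0)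
  rw [fibreCoord, h, coneTuple_last, coneTuple_castSucc, map_mul, toRatFunc_lift, moebius_eq_div]
  exact mul_div_mul_right _ _ hx

theorem fibreCoord_id : fibreCoord (FormTuple.id k (n + 1)) (FormTuple.id k n) = RatFunc.X := by
  have hx : const (X 0 : MvPolynomial (Fin (n + 1)) k) ≠ 0 := const_ne_zero (X_ne_zero 0)
  rw [fibreCoord]
  simp only [FormTuple.id, toRatFunc_last, toRatFunc_castSucc]
  exact mul_div_cancel_right₀ _ hx

/-- The tuple of an admissible quadruple is dominant, as its fibre coordinate is transcendental. -/
theorem Admissible.exists_formTuple {a b c d : MvPolynomial (Fin (n + 1)) k}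
    (h : Admissible a b c d) : ∃ f : FormTuple k (n + 1),
      f.form = coneTuple (monoidForm c d) (monoidForm a b) X := by
  obtain ⟨g, hg⟩ := exists_ofMatrix_eq h
  have hdet := h.det_ne_zero
  have hv : ¬ ∃ u, moebius a b c d = RatFunc.C u := hg ▸ ofMatrix_ne_C g
  obtain ⟨⟨r, hr, ha, hb, hc, hd⟩, -, -⟩ := h
  obtain ⟨m, rfl⟩ : ∃ m : ℕ, r = m + 1 := ⟨(r - 1).toNat, by omega⟩
  have hP : (monoidForm a b).IsHomogeneous (m + 1) :=
    isHomogeneous_monoidForm (by push_cast; exact ha) (by push_cast; exact hb)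
  have hQ : (monoidForm c d).IsHomogeneous m :=
    isHomogeneous_monoidForm (by convert! hc using 1; ring) (by convert! hd using 1; ring)
  have hQ0 : monoidForm c d ≠ 0 := monoidForm_ne_zero (by
    by_contra! h
    exact hdet (by rw [h.1, h.2, mul_zero, mul_zero, sub_zero]))
  refine ⟨⟨coneTuple (monoidForm c d) (monoidForm a b) X, ⟨m + 1, by omega, fun i => ?_⟩,
    fun h e hh h0 hz => ?_⟩, rfl⟩
  · refine Fin.lastCases ?_ (fun j => ?_) i
    · rwa [coneTuple_last]
    · rw [coneTuple_castSucc, lift_X]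
      exact hQ.mul (isHomogeneous_X k _)
  · have hs := toRatFunc_ne_zero hQ0
    have h1 := toRatFunc_bind₁ (t := coneTuple (monoidForm c d) (monoidForm a b) X) (g := X)
      (s := toRatFunc k n (monoidForm c d)) (v := moebius a b c d)
      (fun i => by rw [coneTuple_castSucc, map_mul, toRatFunc_lift])
      (by rw [coneTuple_last, moebius_eq_div, mul_div_cancel₀ _ hs]) hh
    rw [hz, map_zero, eq_comm, mul_eq_zero, or_iff_right (pow_ne_zero e hs),
      evalLast_eq_aeval] at h1
    refine RatFunc.transcendental_of_ne_C _ hv ⟨_, ?_, h1⟩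
    have h2 : (bind₁ X).toRingHom = RingHom.id (MvPolynomial (Fin (n + 1)) k) :=
      MvPolynomial.ringHom_ext (fun c => by simp) fun i => by simp
    rw [h2, RingHom.comp_id, Ne, Polynomial.map_eq_zero_iff (IsFractionRing.injective _ _),
      EmbeddingLike.map_eq_zero_iff]
    exact h0

/-- The identification of `PGL(2, K)` with the set of Möbius functions. -/
def moebiusEquiv (k : Type*) [Field k] (n : ℕ) : PGL(2, functionField k n) ≃ moebiusSet k n :=
  Equiv.ofBijective
    (fun A => ⟨ofMatrix (Function.surjInv Matrix.ProjGenLinGroup.mk_surjective A),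
      ofMatrix_mem _⟩) <| by
    constructor
    · intro A B h
      have h1 := (ofMatrix_eq_iff _ _).mp (congrArg Subtype.val h)
      exact (Function.surjInv_eq Matrix.ProjGenLinGroup.mk_surjective A).symm.trans
        (h1.trans (Function.surjInv_eq Matrix.ProjGenLinGroup.mk_surjective B))
    · rintro ⟨_, a, b, c, d, h, rfl⟩
      obtain ⟨g, hg⟩ := exists_ofMatrix_eq h
      refine ⟨Matrix.ProjGenLinGroup.mk g, Subtype.ext (Eq.trans ?_ hg)⟩
      exact (ofMatrix_eq_iff _ _).mpr
        (Function.surjInv_eq Matrix.ProjGenLinGroup.mk_surjective _)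

theorem moebiusEquiv_mk (g : GL (Fin 2) (functionField k n)) :
    (moebiusEquiv k n (Matrix.ProjGenLinGroup.mk g) : RatFunc (Frac k n)) = ofMatrix g :=
  (ofMatrix_eq_iff _ _).mpr (Function.surjInv_eq Matrix.ProjGenLinGroup.mk_surjective _)

theorem moebiusEquiv_mul (A B : PGL(2, functionField k n)) :
    (moebiusEquiv k n (A * B) : RatFunc (Frac k n)) =
      compose (moebiusEquiv k n A) (moebiusEquiv k n B) := by
  obtain ⟨g, rfl⟩ := Matrix.ProjGenLinGroup.mk_surjective A
  obtain ⟨h, rfl⟩ := Matrix.ProjGenLinGroup.mk_surjective B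
  rw [← map_mul, moebiusEquiv_mk, moebiusEquiv_mk, moebiusEquiv_mk, ofMatrix_mul]

theorem moebiusEquiv_ne_C (A : PGL(2, functionField k n)) :
    ¬ ∃ c, (moebiusEquiv k n A : RatFunc (Frac k n)) = RatFunc.C c := by
  obtain ⟨g, rfl⟩ := Matrix.ProjGenLinGroup.mk_surjective A
  rw [moebiusEquiv_mk]
  exact ofMatrix_ne_C g

theorem exists_tuple_of_pgl (A : PGL(2, functionField k n)) : ∃ f : FormTuple k (n + 1),
    f.LiesOver (FormTuple.id k n) ∧
      fibreCoord f (FormTuple.id k n) = (moebiusEquiv k n A : RatFunc (Frac k n)) := by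
  obtain ⟨a, b, c, d, h, hA⟩ := (moebiusEquiv k n A).2
  obtain ⟨f, hf⟩ := h.exists_formTuple
  refine ⟨f, FormTuple.liesOver_of_coneTuple hf, ?_⟩
  rw [hA, fibreCoord_of_coneTuple hf]

/-- A tuple of forms for the map `(x, t) ↦ (x, u(t))`, with `u` the Möbius function of `A`. -/
def pglTuple (A : PGL(2, functionField k n)) : FormTuple k (n + 1) := (exists_tuple_of_pgl A).choose

theorem pglTuple_liesOver (A : PGL(2, functionField k n)) :
    (pglTuple A).LiesOver (FormTuple.id k n) := (exists_tuple_of_pgl A).choose_spec.1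

theorem fibreCoord_pglTuple (A : PGL(2, functionField k n)) :
    fibreCoord (pglTuple A) (FormTuple.id k n) = (moebiusEquiv k n A : RatFunc (Frac k n)) :=
  (exists_tuple_of_pgl A).choose_spec.2

theorem FormTuple.id_comp_id : (FormTuple.id k n).comp (FormTuple.id k n) ≈ FormTuple.id k n := by
  intro i j
  simp only [FormTuple.comp, FormTuple.id, bind₁_X_right]
  exact mul_comm _ _

/-- The maps `(x, t) ↦ (x, u(t))` with `u` in the Möbius group. -/
def pglToRatMap (k : Type*) [Field k] (n : ℕ) :
    PGL(2, functionField k n) →* RatMap k (n + 1) where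
  toFun A := Quotient.mk _ (pglTuple A)
  map_one' := by
    refine RatMap.mk_eq_mk.mpr (((pglTuple_liesOver 1).fibreCoord_eq_iff
      FormTuple.id_liesOver_id).mp ?_)
    rw [fibreCoord_pglTuple, fibreCoord_id, ← Matrix.ProjGenLinGroup.mk_one, moebiusEquiv_mk,
      ofMatrix_eq_X_iff, map_one]
  map_mul' A B := by
    have hv : ¬ ∃ c, fibreCoord (pglTuple B) (FormTuple.id k n) = RatFunc.C c := by
      rw [fibreCoord_pglTuple]
      exact moebiusEquiv_ne_C B
    have hover : ((pglTuple A).comp (pglTuple B)).LiesOver (FormTuple.id k n) :=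
      ((pglTuple_liesOver A).comp (pglTuple_liesOver B)).congr (Setoid.refl _)
        FormTuple.id_comp_id
    refine RatMap.mk_eq_mk.mpr (((pglTuple_liesOver (A * B)).fibreCoord_eq_iff hover).mp ?_)
    rw [(pglTuple_liesOver B).fibreCoord_comp hv, fibreCoord_pglTuple, fibreCoord_pglTuple,
      fibreCoord_pglTuple, moebiusEquiv_mul]

/-- The embedding of `PGL(2, K)` in the group of maps compatible with the projection. -/
def pglHom (k : Type*) [Field k] (n : ℕ) : PGL(2, functionField k n) →* projGroup k n :=
  (pglToRatMap k n).toHomUnits.codRestrict (projGroup k n) fun A =>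
    ⟨1, RatMap.liesOver_mk.mpr (pglTuple_liesOver A)⟩

theorem pglHom_hasForm {A : PGL(2, functionField k n)} {a b c d : MvPolynomial (Fin (n + 1)) k}
    (h : Admissible a b c d) (hA : (moebiusEquiv k n A : RatFunc (Frac k n)) = moebius a b c d) :
    ((pglHom k n A : Cr k (n + 1)) : RatMap k (n + 1)).HasForm
      (coneTuple (monoidForm c d) (monoidForm a b) X) := by
  obtain ⟨f, hf⟩ := h.exists_formTuple
  have hover : f.LiesOver (FormTuple.id k n) := FormTuple.liesOver_of_coneTuple hf
  refine ⟨f, hf, RatMap.mk_eq_mk.mpr ((hover.fibreCoord_eq_iff (pglTuple_liesOver A)).mp ?_)⟩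
  rw [fibreCoord_of_coneTuple hf, fibreCoord_pglTuple, hA]

theorem pglHom_injective : Function.Injective (pglHom k n) := by
  intro A B h
  have h1 : (Quotient.mk _ (pglTuple A) : RatMap k (n + 1)) = Quotient.mk _ (pglTuple B) :=
    congrArg (fun F : projGroup k n => ((F : Cr k (n + 1)) : RatMap k (n + 1))) h
  have h2 := ((pglTuple_liesOver A).fibreCoord_eq_iff (pglTuple_liesOver B)).mpr
    (RatMap.mk_eq_mk.mp h1)
  rw [fibreCoord_pglTuple, fibreCoord_pglTuple] at h2
  exact (moebiusEquiv k n).injective (Subtype.ext h2)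

theorem RatMap.HasForm.eq {F F' : RatMap k n} {f : Fin (n + 1) → MvPolynomial (Fin (n + 1)) k}
    (h : F.HasForm f) (h' : F'.HasForm f) : F = F' := by
  obtain ⟨t, ht, rfl⟩ := h
  obtain ⟨t', ht', rfl⟩ := h'
  refine RatMap.mk_eq_mk.mpr fun i j => ?_
  rw [ht, ht', mul_comm]

/-- A Cremona map over the identity has the normal form of an admissible quadruple. -/
theorem exists_admissible_of_liesOver_one {F : Cr k (n + 1)}
    (hF : (F : RatMap k (n + 1)).LiesOver 1) : ∃ a b c d : MvPolynomial (Fin (n + 1)) k,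
      Admissible a b c d ∧ (F : RatMap k (n + 1)).HasForm
        (coneTuple (monoidForm c d) (monoidForm a b) X) := by
  obtain ⟨f, hf⟩ := Quotient.exists_rep (F : RatMap k (n + 1))
  rw [← hf] at hF
  have hfg : f.LiesOver (FormTuple.id k n) := RatMap.liesOver_mk.mp hF
  obtain ⟨f', -, hf', -⟩ := RatMap.exists_leftInverse_tuple F hf
  obtain ⟨q, p, e, d, hgd, hqe, hpe, hq1, hp1, hrel, hpos, t, ht, htf⟩ :=
    hfg.exists_coneTuple hf'
  obtain rfl : d = 1 := (hgd 0).inj_right (isHomogeneous_X k 0) (X_ne_zero 0)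
  obtain ⟨c, d, hc, hd, rfl⟩ := exists_eq_monoidForm hqe hq1
  obtain ⟨a, b, ha, hb, rfl⟩ := exists_eq_monoidForm hpe hp1
  refine ⟨a, b, c, d, ⟨⟨e + 1, by omega, ?_, ?_, ?_, ?_⟩, ?_, hrel.symm⟩, t, ht,
    (RatMap.mk_eq_mk.mpr htf).trans hf⟩
  · exact_mod_cast ha
  · exact_mod_cast hb
  · convert! hc using 1
    ring
  · convert! hd using 1
    ring
  · by_contra! h
    obtain ⟨rfl, rfl⟩ := h
    simp [lastEquiv_monoidForm] at hpos

theorem range_pglHom_eq_ker : (pglHom k n).range = (inducedHom k n).ker := by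
  ext F
  rw [MonoidHom.mem_ker, inducedHom_eq_iff]
  constructor
  · rintro ⟨A, rfl⟩
    exact RatMap.liesOver_mk.mpr (pglTuple_liesOver A)
  · intro hF
    obtain ⟨a, b, c, d, h, hform⟩ := exists_admissible_of_liesOver_one hF
    have hA := pglHom_hasForm (A := (moebiusEquiv k n).symm ⟨_, a, b, c, d, h, rfl⟩) h
      (by rw [Equiv.apply_symm_apply])
    exact ⟨_, Subtype.ext (Units.ext (hA.eq hform))⟩

end Cremona

end

open Cremona in
theorem mainTheorem7 {k : Type*} [Field k] [IsAlgClosed k] [CharZero k] (n : ℕ) (hn : 1 ≤ n) :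
    ∃ (J : Subgroup (Cr k (n + 1))) (ρ : J →* Cr k n),
      (∀ F : Cr k (n + 1), F ∈ J ↔ IsDeJonquieres 1 (center k n) F) ∧
      (∀ (F : J) (G : Cr k n), InducesOnLines (F : Cr k (n + 1)) G ↔ G = ρ F) ∧
      -- (i)
      (∀ F : Cr k (n + 1), F ∈ J ↔
        ∃ (g : Fin (n + 1) → MvPolynomial (Fin (n + 1)) k) (q f : MvPolynomial (Fin (n + 2)) k),
          (∃ G : Cr k n, (G : RatMap k n).HasForm g) ∧
          IsLastMonoid q ∧ IsLastMonoid f ∧ IsRelPrime q f ∧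
          (0 < q.degreeOf (Fin.last (n + 1)) ∨ 0 < f.degreeOf (Fin.last (n + 1))) ∧
          (F : RatMap k (n + 1)).HasForm (coneTuple q f g)) ∧
      ∃ (θ : PGL(2, functionField k n) ≃ moebiusSet k n) (ψ : PGL(2, functionField k n) →* J),
        -- (ii)
        (∀ g : GL (Fin 2) (functionField k n),
          (θ (Matrix.ProjGenLinGroup.mk g) : RatFunc (Frac k n)) = ofMatrix g) ∧
        (∀ A B, (θ (A * B) : RatFunc (Frac k n)) = compose (θ A) (θ B)) ∧
        -- (iii)
        (∀ (A : PGL(2, functionField k n)) (a b c d : MvPolynomial (Fin (n + 1)) k),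
          Admissible a b c d → (θ A : RatFunc (Frac k n)) = moebius a b c d →
          ((ψ A : Cr k (n + 1)) : RatMap k (n + 1)).HasForm
            (coneTuple (monoidForm c d) (monoidForm a b) MvPolynomial.X)) ∧
        Function.Injective ψ ∧
        -- (iv)
        ψ.range = ρ.ker ∧
        (∀ (a b c d : MvPolynomial (Fin (n + 1)) k) (F : Cr k (n + 1)), Admissible a b c d →
          (F : RatMap k (n + 1)).HasForm
            (coneTuple (monoidForm c d) (monoidForm a b) MvPolynomial.X) →
          FixesGeneralLine F) := by
  have : Infinite k := IsAlgClosed.instInfinite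
  refine ⟨projGroup k n, inducedHom k n, mem_projGroup_iff_isDeJonquieres, inducesOnLines_iff,
    mem_projGroup_iff_exists_coneTuple, moebiusEquiv k n, pglHom k n, moebiusEquiv_mk,
    moebiusEquiv_mul, fun A a b c d h hA => pglHom_hasForm h hA, pglHom_injective,
    range_pglHom_eq_ker, ?_⟩
  rintro a b c d F - ⟨t, ht, hF⟩
  apply fixesGeneralLine_of_liesOver_one
  rw [← hF]
  exact RatMap.liesOver_mk.mpr (FormTuple.liesOver_of_coneTuple ht)
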